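/- **Setting.** Let $A$ be a semilattice of groups, i.e. an inverse semigroup with $aa^{-1}=a^{-1}a$ for all $a\in A$, and let $S$ be an E-unitary inverse semigroup (every element lying above an idempotent in the natural partial order is an idempotent). Let $A\xrightarrow{i}U\xrightarrow{j}S$ be an extension of $A$ by $S$: $U$ is an inverse semigroup, $i$ is a monomorphism, $j$ is an idempotent-separating epimorphism, and $i(A)=j^{-1}(E(S))$. Let $\rho:S\to U$ be an order-preserving transversal of $j$: $j\circ\rho=\mathrm{id}_S$, $\rho(E(S))\subseteq E(U)$, and $s\le t$ implies $\rho(s)\le\rho(t)$ for the natural partial orders. Put $\alpha(e)=i^{-1}(\rho(e))$ for $e\in E(S)$ and $\lambda_s(a)=i^{-1}(\rho(s)\,i(a)\,\rho(s)^{-1})$ for $s\in S$, $a\in A$. Let $\mathcal G(S)$ be the maximum group image of $S$, i.e. the quotient of $S$ by the congruence relating $s$ and $t$ whenever they have a common lower bound. For $g\in\mathcal G(S)$ let $\theta_g:\mathcal D_{g^{-1}}\to\mathcal D_g$ be the isomorphism between two-sided ideals of $A$ given by $$\theta_g(a)=\lambda_s(a),\qquad\text{where } s\in g,\ \alpha(s^{-1}s)=aa^{-1},$$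 whose domain $\mathcal D_{g^{-1}}$ consists of all $a\in A$ for which such an $s$ exists (the maps $\theta_g$ are the action part of the twisted partial action of $\mathcal G(S)$ on $A$ induced by the extension and $\rho$). A multiplier of a semigroup $T$ is a pair $m$ of maps $t\mapsto mt$ and $t\mapsto tm$ from $T$ to $T$ with $m(tu)=(mt)u$, $(tu)m=t(um)$ and $t(mu)=(tm)u$ for all $t,u\in T$; the multipliers of $T$ form a monoid $\mathcal M(T)$ under composition. Let $\Sigma(A)$ be the monoid, under composition of partial maps, of all isomorphisms between two-sided ideals of $A$. Write $\psi\sim\varphi$ if $\psi,\varphi\in\Sigma(A)$ have the same domain and the same range and there is an invertible $m\in\mathcal M(\operatorname{ran}\varphi)$ with $\psi(s)=m\varphi(s)m^{-1}$ for all $s\in\operatorname{dom}\varphi$. Then $\sim$ is a congruence; let $\varsigma(A)=\Sigma(A)/{\sim}$. **Proposition.** The map $\psi:\mathcal G(S)\to\varsigma(A)$, $g\mapsto[\theta_g]$, is a unital partial homomorphism: $\psi(1)=1$ and, for all $g,h\in\mathcal G(S)$, $$\psi(g^{-1})\psi(g)\psi(h)=\psi(g^{-1})\psi(gh),\qquad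 \psi(g)\psi(h)\psi(h^{-1})=\psi(gh)\psi(h^{-1}).$$ -/

import Mathlib

namespace InverseExt

/-! ### Inverse semigroups and semilattices of groups -/

/-- An inverse semigroup: every element `a` has a unique inverse, that is, a unique `b` with
`a * b * a = a` and `b * a * b = b`; it is denoted `a⁻¹`. -/
class InverseSemigroup (S : Type*) extends Semigroup S, Inv S where
  mul_inv_mul : ∀ a : S, a * a⁻¹ * a = a
  inv_mul_inv : ∀ a : S, a⁻¹ * a * a⁻¹ = a⁻¹
  inv_unique : ∀ a b : S, a * b * a = a → b * a * b = b → b = a⁻¹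

/-- A semilattice of groups (Clifford semigroup): an inverse semigroup `A` that is the union of its
subgroups `A_e = {a | a * a⁻¹ = a⁻¹ * a = e}`, where `e` runs over the semilattice of idempotents
of `A`. -/
class SemilatticeOfGroups (A : Type*) extends InverseSemigroup A where
  mul_inv_eq_inv_mul : ∀ a : A, a * a⁻¹ = a⁻¹ * a

section Basic

variable {S : Type*} [InverseSemigroup S]

theorem mul_inv_mul (a : S) : a * a⁻¹ * a = a := InverseSemigroup.mul_inv_mul a

theorem inv_mul_inv (a : S) : a⁻¹ * a * a⁻¹ = a⁻¹ := InverseSemigroup.inv_mul_inv a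

theorem inv_unique {a b : S} (h : a * b * a = a) (h' : b * a * b = b) : b = a⁻¹ :=
  InverseSemigroup.inv_unique a b h h'

theorem mul_inv_mul' (a : S) : a * (a⁻¹ * a) = a := by rw [← mul_assoc, mul_inv_mul]

theorem inv_mul_inv' (a : S) : a⁻¹ * (a * a⁻¹) = a⁻¹ := by rw [← mul_assoc, inv_mul_inv]

theorem mul_inv_cancel_mul (a x : S) : a * (a⁻¹ * (a * x)) = a * x := by
  rw [← mul_assoc, ← mul_assoc, mul_inv_mul]

theorem inv_mul_cancel_mul (a x : S) : a⁻¹ * (a * (a⁻¹ * x)) = a⁻¹ * x := by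
  rw [← mul_assoc, ← mul_assoc, inv_mul_inv]

theorem inv_inv' (a : S) : a⁻¹⁻¹ = a := (inv_unique (inv_mul_inv a) (mul_inv_mul a)).symm

theorem idem_inv {e : S} (he : IsIdempotentElem e) : e⁻¹ = e :=
  (inv_unique (by rw [he.eq, he.eq]) (by rw [he.eq, he.eq])).symm

theorem idem_mul_inv (a : S) : IsIdempotentElem (a * a⁻¹) := by
  unfold IsIdempotentElem
  rw [← mul_assoc, mul_inv_mul]

theorem idem_inv_mul (a : S) : IsIdempotentElem (a⁻¹ * a) := by
  unfold IsIdempotentElem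
  rw [← mul_assoc, inv_mul_inv]

theorem idem_cancel {e : S} (he : IsIdempotentElem e) (x : S) : e * (e * x) = e * x := by
  rw [← mul_assoc, he.eq]

theorem idem_mul {e f : S} (he : IsIdempotentElem e) (hf : IsIdempotentElem f) :
    IsIdempotentElem (e * f) := by
  have h1 : f * (e * f)⁻¹ * e = (e * f)⁻¹ := by
    apply inv_unique
    · have := mul_inv_mul (e * f)
      simpa only [mul_assoc, idem_cancel he, idem_cancel hf] using this
    · have := congrArg (fun x => f * x * e) (inv_mul_inv (e * f))
      simpa only [mul_assoc, idem_cancel he, idem_cancel hf] using this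
  have h2 : IsIdempotentElem (e * f)⁻¹ := by
    have := congrArg (fun x => f * x * e) (inv_mul_inv (e * f))
    unfold IsIdempotentElem
    rw [← h1]
    simpa only [mul_assoc, idem_cancel he, idem_cancel hf] using this
  have h3 := idem_inv h2
  rw [inv_inv'] at h3
  rwa [h3]

/-- Idempotents of an inverse semigroup commute. -/
theorem idem_comm {e f : S} (he : IsIdempotentElem e) (hf : IsIdempotentElem f) :
    e * f = f * e := by
  have h1 := idem_mul he hf
  have h2 := idem_mul hf he
  have h : f * e = (e * f)⁻¹ := by
    apply inv_unique
    · have := h1.eq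
      simpa only [mul_assoc, idem_cancel he, idem_cancel hf] using this
    · have := h2.eq
      simpa only [mul_assoc, idem_cancel he, idem_cancel hf] using this
  rw [h, idem_inv h1]

theorem mul_inv_rev' (a b : S) : (a * b)⁻¹ = b⁻¹ * a⁻¹ := by
  have hc := idem_comm (idem_mul_inv b) (idem_inv_mul a)
  symm
  apply inv_unique
  · calc a * b * (b⁻¹ * a⁻¹) * (a * b) = a * ((b * b⁻¹) * (a⁻¹ * a)) * b := by
          simp only [mul_assoc]
      _ = a * b := by
          rw [hc]
          simp only [mul_assoc, mul_inv_cancel_mul, mul_inv_mul']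
  · calc b⁻¹ * a⁻¹ * (a * b) * (b⁻¹ * a⁻¹) = b⁻¹ * ((a⁻¹ * a) * (b * b⁻¹)) * a⁻¹ := by
          simp only [mul_assoc]
      _ = b⁻¹ * a⁻¹ := by
          rw [← hc]
          simp only [mul_assoc, inv_mul_cancel_mul, inv_mul_inv']

theorem idem_conj {e : S} (he : IsIdempotentElem e) (a : S) :
    IsIdempotentElem (a * e * a⁻¹) := by
  have hc := idem_comm (idem_inv_mul a) he
  unfold IsIdempotentElem
  calc a * e * a⁻¹ * (a * e * a⁻¹) = a * (e * ((a⁻¹ * a) * e)) * a⁻¹ := by simp only [mul_assoc]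
    _ = a * (e * e) * (a⁻¹ * a * a⁻¹) := by rw [hc]; simp only [mul_assoc]
    _ = a * e * a⁻¹ := by rw [he.eq, inv_mul_inv]

/-- Moving an idempotent from the right of `a` to its left. -/
theorem mul_idem {e : S} (he : IsIdempotentElem e) (a : S) : a * e = a * e * a⁻¹ * a := by
  calc a * e = a * (a⁻¹ * a * e) := by rw [← mul_assoc, mul_inv_mul']
    _ = a * e * a⁻¹ * a := by rw [idem_comm (idem_inv_mul a) he]; simp only [mul_assoc]

theorem map_inv' {T : Type*} [InverseSemigroup T] (f : S →ₙ* T) (a : S) : f a⁻¹ = (f a)⁻¹ :=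
  inv_unique (by rw [← map_mul, ← map_mul, mul_inv_mul])
    (by rw [← map_mul, ← map_mul, inv_mul_inv])

/-- The natural partial order of an inverse semigroup: `a ≤ b` iff `a = e * b` for some
idempotent `e`. -/
def NatLE (a b : S) : Prop := ∃ e : S, IsIdempotentElem e ∧ a = e * b

theorem natLE_mul_idem {e : S} (he : IsIdempotentElem e) (a : S) : NatLE (a * e) a :=
  ⟨a * e * a⁻¹, idem_conj he a, mul_idem he a⟩

/-- If `a ≤ b` then `a = (a * a⁻¹) * b`. -/
theorem natLE_left {a b : S} (h : NatLE a b) : a = a * a⁻¹ * b := by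
  obtain ⟨e, he, rfl⟩ := h
  rw [mul_inv_rev', idem_inv he]
  calc e * b = e * (b * b⁻¹ * b) := by rw [mul_inv_mul]
    _ = e * e * (b * b⁻¹) * b := by rw [he.eq]; simp only [mul_assoc]
    _ = e * (e * (b * b⁻¹)) * b := by simp only [mul_assoc]
    _ = e * b * (b⁻¹ * e) * b := by
      rw [idem_comm he (idem_mul_inv b)]; simp only [mul_assoc]

/-- If `a ≤ b` then `a = b * (a⁻¹ * a)`. -/
theorem natLE_right {a b : S} (h : NatLE a b) : a = b * (a⁻¹ * a) := by
  obtain ⟨e, he, rfl⟩ := h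
  rw [mul_inv_rev', idem_inv he]
  calc e * b = e * (b * b⁻¹) * b := by rw [mul_assoc, mul_inv_mul]
    _ = b * b⁻¹ * (e * e) * b := by rw [he.eq, idem_comm he (idem_mul_inv b)]
    _ = b * (b⁻¹ * e * (e * b)) := by simp only [mul_assoc]

theorem natLE_antisymm {a b : S} (h : NatLE a b) (h' : a⁻¹ * a = b⁻¹ * b) : a = b := by
  rw [natLE_right h, h', mul_inv_mul']

end Basic

/-- Idempotents of a semilattice of groups are central. -/
theorem idem_central {A : Type*} [SemilatticeOfGroups A] {e : A} (he : IsIdempotentElem e)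
    (x : A) : e * x = x * e := by
  have q := SemilatticeOfGroups.mul_inv_eq_inv_mul (x * e)
  rw [mul_inv_rev', idem_inv he] at q
  have q' : x * e * x⁻¹ = e * (x⁻¹ * x) := by
    calc x * e * x⁻¹ = x * e * (e * x⁻¹) := by
          rw [← mul_assoc, mul_assoc x e e, he.eq]
      _ = e * (x⁻¹ * x) * e := by rw [q]; simp only [mul_assoc]
      _ = e * (x⁻¹ * x) := by
          rw [mul_assoc, ← idem_comm he (idem_inv_mul x), ← mul_assoc, he.eq]
  calc e * x = e * (x * x⁻¹) * x := by rw [mul_assoc, mul_inv_mul]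
    _ = x * e := by rw [SemilatticeOfGroups.mul_inv_eq_inv_mul, ← q', ← mul_idem he]

/-! ### The maximum group image -/

section MaxGroup

variable (S : Type*) [InverseSemigroup S]

/-- `S` is E-unitary: every element above an idempotent in the natural partial order is an
idempotent. -/
def IsEUnitary : Prop := ∀ e s : S, IsIdempotentElem e → NatLE e s → IsIdempotentElem s

variable {S} in
theorem sigma_aux {s t : S} :
    (∃ u : S, NatLE u s ∧ NatLE u t) ↔
      ∃ e f : S, IsIdempotentElem e ∧ IsIdempotentElem f ∧ e * s = f * t := by
  constructor
  · rintro ⟨u, ⟨e, he, rfl⟩, ⟨f, hf, h⟩⟩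
    exact ⟨e, f, he, hf, h⟩
  · rintro ⟨e, f, he, hf, h⟩
    exact ⟨e * s, ⟨e, he, rfl⟩, ⟨f, hf, h⟩⟩

/-- The minimum group congruence of an inverse semigroup: two elements are related iff they have
a common lower bound in the natural partial order. -/
def minGroupCon : Con S where
  r s t := ∃ u : S, NatLE u s ∧ NatLE u t
  iseqv := by
    refine ⟨fun s => ⟨s, ?_, ?_⟩, ?_, ?_⟩
    · exact ⟨s * s⁻¹, idem_mul_inv s, (mul_inv_mul s).symm⟩
    · exact ⟨s * s⁻¹, idem_mul_inv s, (mul_inv_mul s).symm⟩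
    · rintro s t ⟨u, h, h'⟩
      exact ⟨u, h', h⟩
    · intro s t r h h'
      rw [sigma_aux] at *
      obtain ⟨e, f, he, hf, h⟩ := h
      obtain ⟨e', f', he', hf', h'⟩ := h'
      refine ⟨e' * e, f * f', idem_mul he' he, idem_mul hf hf', ?_⟩
      rw [mul_assoc, h, mul_assoc, ← h', ← mul_assoc, ← mul_assoc, idem_comm he' hf]
  mul' := by
    intro s t s' t' h h'
    rw [sigma_aux] at *
    obtain ⟨e, f, he, hf, h⟩ := h
    obtain ⟨e', f', he', hf', h'⟩ := h'
    refine ⟨e * (s * e' * s⁻¹), f * (t * f' * t⁻¹), idem_mul he (idem_conj he' s),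
      idem_mul hf (idem_conj hf' t), ?_⟩
    calc e * (s * e' * s⁻¹) * (s * s') = e * (s * e' * s⁻¹ * s) * s' := by simp only [mul_assoc]
      _ = (e * s) * (e' * s') := by rw [← mul_idem he']; simp only [mul_assoc]
      _ = f * (t * f') * t' := by rw [h, h']; simp only [mul_assoc]
      _ = f * (t * f' * t⁻¹) * (t * t') := by
        nth_rewrite 1 [mul_idem hf' t]
        simp only [mul_assoc]

/-- The maximum group image `G(S)`: the quotient of `S` by its minimum group congruence. -/
def MaxGroupImage : Type _ := (minGroupCon S).Quotient

variable {S}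

/-- The class in `G(S)` of an element of `S`; thus "`s ∈ g`" means `toMaxGroup s = g`. -/
def toMaxGroup (s : S) : MaxGroupImage S := ((s : S) : (minGroupCon S).Quotient)

theorem toMaxGroup_eq {s t : S} :
    toMaxGroup s = toMaxGroup t ↔ ∃ u : S, NatLE u s ∧ NatLE u t :=
  (minGroupCon S).eq

theorem toMaxGroup_surj (g : MaxGroupImage S) : ∃ s : S, toMaxGroup s = g :=
  Quotient.exists_rep g

theorem toMaxGroup_of_le {s t : S} (h : NatLE s t) : toMaxGroup s = toMaxGroup t :=
  toMaxGroup_eq.2 ⟨s, ⟨s * s⁻¹, idem_mul_inv s, (mul_inv_mul s).symm⟩, h⟩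

theorem toMaxGroup_idem {e f : S} (he : IsIdempotentElem e) (hf : IsIdempotentElem f) :
    toMaxGroup e = toMaxGroup f :=
  toMaxGroup_eq.2 ⟨f * e, ⟨f, hf, rfl⟩, ⟨e, he, (idem_comm he hf).symm⟩⟩

instance : Semigroup (MaxGroupImage S) :=
  inferInstanceAs (Semigroup (minGroupCon S).Quotient)

theorem toMaxGroup_mul (s t : S) : toMaxGroup (s * t) = toMaxGroup s * toMaxGroup t := rfl

/-- The inverse of the class of `s` is the class of `s⁻¹`. -/
instance : Inv (MaxGroupImage S) where
  inv := Quotient.lift (fun s => toMaxGroup s⁻¹) (by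
    intro s t h
    have h : ∃ u : S, NatLE u s ∧ NatLE u t := h
    obtain ⟨u, ⟨e, he, h1⟩, ⟨f, hf, h2⟩⟩ := h
    refine toMaxGroup_eq.2 ⟨u⁻¹, ?_, ?_⟩
    · rw [h1, mul_inv_rev', idem_inv he]
      exact natLE_mul_idem he _
    · rw [h2, mul_inv_rev', idem_inv hf]
      exact natLE_mul_idem hf _)

theorem toMaxGroup_inv (s : S) : toMaxGroup s⁻¹ = (toMaxGroup s)⁻¹ := rfl

/-- The identity of `G(S)` is the common class of all idempotents of `S`. -/
noncomputable instance [Nonempty S] : Group (MaxGroupImage S) where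
  one := toMaxGroup (Classical.arbitrary S * (Classical.arbitrary S)⁻¹)
  one_mul g := by
    obtain ⟨s, rfl⟩ := toMaxGroup_surj g
    exact toMaxGroup_of_le ⟨_, idem_mul_inv _, rfl⟩
  mul_one g := by
    obtain ⟨s, rfl⟩ := toMaxGroup_surj g
    exact toMaxGroup_of_le (natLE_mul_idem (idem_mul_inv _) s)
  inv_mul_cancel g := by
    obtain ⟨s, rfl⟩ := toMaxGroup_surj g
    exact toMaxGroup_idem (idem_inv_mul s) (idem_mul_inv _)

theorem toMaxGroup_idem_eq_one [Nonempty S] {e : S} (he : IsIdempotentElem e) :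
    toMaxGroup e = 1 :=
  toMaxGroup_idem he (idem_mul_inv _)

theorem toMaxGroup_eq_one_iff [Nonempty S] (hS : IsEUnitary S) {s : S} :
    toMaxGroup s = 1 ↔ IsIdempotentElem s := by
  constructor
  · intro h
    obtain ⟨u, h1, ⟨f, hf, h2⟩⟩ := toMaxGroup_eq.1 h
    refine hS u s ?_ h1
    rw [h2]
    exact idem_mul hf (idem_mul_inv _)
  · exact toMaxGroup_idem_eq_one

/-- In an E-unitary inverse semigroup, two elements of the same class of `G(S)` are compatible. -/
theorem compat_of_eq (hS : IsEUnitary S) {s t : S} (h : toMaxGroup s = toMaxGroup t) :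
    IsIdempotentElem (s⁻¹ * t) ∧ IsIdempotentElem (s * t⁻¹) := by
  have : Nonempty S := ⟨s⟩
  rw [← toMaxGroup_eq_one_iff hS, ← toMaxGroup_eq_one_iff hS, toMaxGroup_mul, toMaxGroup_mul,
    toMaxGroup_inv, toMaxGroup_inv, h]
  simp

theorem eq_of_dom_eq (hS : IsEUnitary S) {s t : S} (h : toMaxGroup s = toMaxGroup t)
    (h' : s⁻¹ * s = t⁻¹ * t) : s = t := by
  refine natLE_antisymm ⟨s * t⁻¹, (compat_of_eq hS h).2, ?_⟩ h'
  rw [mul_assoc, ← h', mul_inv_mul']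

theorem eq_of_ran_eq (hS : IsEUnitary S) {s t : S} (h : toMaxGroup s = toMaxGroup t)
    (h' : s * s⁻¹ = t * t⁻¹) : s = t := by
  have h2 : s⁻¹ = t⁻¹ := by
    apply eq_of_dom_eq hS
    · rw [toMaxGroup_inv, toMaxGroup_inv, h]
    · rw [inv_inv', inv_inv', h']
  rw [← inv_inv' s, h2, inv_inv']

end MaxGroup

/-! ### Multipliers -/

/-- A multiplier of a semigroup `S`: a pair of maps `s ↦ ms` (`left`) and `s ↦ sm` (`right`) with
`m(st) = (ms)t`, `(st)m = s(tm)` and `s(mt) = (sm)t`. -/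
@[ext]
structure Multiplier (S : Type*) [Semigroup S] where
  left : S → S
  right : S → S
  left_mul : ∀ s t : S, left (s * t) = left s * t
  mul_right : ∀ s t : S, right (s * t) = s * right t
  mul_left : ∀ s t : S, s * left t = right s * t

namespace Multiplier

/-- Multipliers form a monoid under composition: `(mn)s = m(ns)` and `s(mn) = (sm)n`. -/
instance (S : Type*) [Semigroup S] : Monoid (Multiplier S) where
  mul m n :=
    { left := fun s => m.left (n.left s)
      right := fun s => n.right (m.right s)
      left_mul := fun s t => by rw [n.left_mul, m.left_mul]
      mul_right := fun s t => by rw [m.mul_right, n.mul_right]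
      mul_left := fun s t => by rw [m.mul_left, n.mul_left] }
  one := ⟨id, id, fun _ _ => rfl, fun _ _ => rfl, fun _ _ => rfl⟩
  mul_assoc _ _ _ := rfl
  one_mul _ := rfl
  mul_one _ := rfl

/-- The conjugate `m s m⁻¹ = (m s) m⁻¹` of `s` by an invertible multiplier `m`. -/
def conj {S : Type*} [Semigroup S] (m : (Multiplier S)ˣ) (s : S) : S :=
  (m⁻¹).val.right (m.val.left s)

theorem conj_one {S : Type*} [Semigroup S] (s : S) : conj (1 : (Multiplier S)ˣ) s = s := rfl

/-- Transport of multipliers along an isomorphism. -/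
def transport {S T : Type*} [Semigroup S] [Semigroup T] (e : S ≃* T) :
    Multiplier S →* Multiplier T where
  toFun m :=
    { left := fun t => e (m.left (e.symm t))
      right := fun t => e (m.right (e.symm t))
      left_mul := fun s t => by rw [map_mul, m.left_mul, map_mul, e.apply_symm_apply]
      mul_right := fun s t => by rw [map_mul, m.mul_right, map_mul, e.apply_symm_apply]
      mul_left := fun s t => by
        have := congrArg e (m.mul_left (e.symm s) (e.symm t))
        simpa only [map_mul, e.apply_symm_apply] using this }
  map_one' := by
    apply Multiplier.ext
    · funext t
      exact e.apply_symm_apply t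
    · funext t
      exact e.apply_symm_apply t
  map_mul' m n := by
    apply Multiplier.ext
    · funext t
      change e (m.left (n.left (e.symm t))) = e (m.left (e.symm (e (n.left (e.symm t)))))
      rw [e.symm_apply_apply]
    · funext t
      change e (n.right (m.right (e.symm t))) = e (n.right (e.symm (e (m.right (e.symm t)))))
      rw [e.symm_apply_apply]

end Multiplier

/-! ### Isomorphisms between ideals and the monoid `ς(A)` -/

/-- Two-sided ideals of a semigroup; the empty set is allowed. -/
def IsTwoSidedIdeal {A : Type*} [Semigroup A] (I : Set A) : Prop :=
  ∀ a ∈ I, ∀ x : A, x * a ∈ I ∧ a * x ∈ I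

/-- `Σ(A)`: the elements of the symmetric inverse monoid on `A` (partial bijections `A ≃. A`, where
`b ∈ φ a` means that `φ` is defined at `a` and takes the value `b` there) that are isomorphisms
between two-sided ideals of `A`. -/
@[ext]
structure IdealIso (A : Type*) [Semigroup A] where
  toPEquiv : A ≃. A
  dom_ideal : IsTwoSidedIdeal {a : A | ∃ b, b ∈ toPEquiv a}
  ran_ideal : IsTwoSidedIdeal {b : A | ∃ a, b ∈ toPEquiv a}
  map_mul : ∀ a a' b b' : A, b ∈ toPEquiv a → b' ∈ toPEquiv a' → b * b' ∈ toPEquiv (a * a')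

namespace IdealIso

section Semi

variable {A : Type*} [Semigroup A]

/-- The domain of an isomorphism between ideals, as a subsemigroup. -/
def dom (φ : IdealIso A) : Subsemigroup A where
  carrier := {a : A | ∃ b, b ∈ φ.toPEquiv a}
  mul_mem' := fun {a b} _ hb => (φ.dom_ideal b hb a).1

/-- The range of an isomorphism between ideals, as a subsemigroup. -/
def ran (φ : IdealIso A) : Subsemigroup A where
  carrier := {b : A | ∃ a, b ∈ φ.toPEquiv a}
  mul_mem' := fun {a b} _ hb => (φ.ran_ideal b hb a).1

theorem mem_dom {φ : IdealIso A} {a : A} : a ∈ φ.dom ↔ ∃ b, b ∈ φ.toPEquiv a := Iff.rfl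

theorem mem_ran {φ : IdealIso A} {b : A} : b ∈ φ.ran ↔ ∃ a, b ∈ φ.toPEquiv a := Iff.rfl

theorem val_unique (φ : IdealIso A) {a b c : A} (h : b ∈ φ.toPEquiv a) (h' : c ∈ φ.toPEquiv a) :
    b = c := Option.mem_unique h h'

/-- The relation `ψ ∼ φ`: same domain, same range, and `ψ(s) = m φ(s) m⁻¹` for all `s ∈ dom φ`, for
some invertible multiplier `m` of the range. -/
def Sim (ψ φ : IdealIso A) : Prop :=
  φ.dom = ψ.dom ∧ φ.ran = ψ.ran ∧
    ∃ m : (Multiplier φ.ran)ˣ, ∀ (s : A) (t : φ.ran), (t : A) ∈ φ.toPEquiv s →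
      ((Multiplier.conj m t : φ.ran) : A) ∈ ψ.toPEquiv s

end Semi

variable {A : Type*} [InverseSemigroup A]

/-- `Σ(A)` is a monoid under composition: `(φ * ψ)(a) = φ(ψ(a))`, defined wherever this makes
sense. -/
instance : Monoid (IdealIso A) where
  mul φ ψ :=
    { toPEquiv := ψ.toPEquiv.trans φ.toPEquiv
      dom_ideal := by
        rintro a ⟨c, hc⟩ x
        obtain ⟨b, hb, hc⟩ := (PEquiv.mem_trans _ _ _ _).1 hc
        constructor
        · obtain ⟨b', hb'⟩ := (ψ.dom_ideal a ⟨b, hb⟩ x).1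
          obtain ⟨b', hb'⟩ := (ψ.dom_ideal _ (ψ.dom_ideal a ⟨b, hb⟩ x).1 a⁻¹).2
          obtain ⟨c', hc'⟩ := (φ.dom_ideal b ⟨c, hc⟩ b').1
          refine ⟨c', (PEquiv.mem_trans _ _ _ _).2 ⟨b' * b, ?_, hc'⟩⟩
          have := ψ.map_mul _ _ _ _ hb' hb
          simpa only [mul_assoc, mul_inv_mul'] using this
        · obtain ⟨b', hb'⟩ := (ψ.dom_ideal _ (ψ.dom_ideal a ⟨b, hb⟩ x).2 a⁻¹).1
          obtain ⟨c', hc'⟩ := (φ.dom_ideal b ⟨c, hc⟩ b').2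
          refine ⟨c', (PEquiv.mem_trans _ _ _ _).2 ⟨b * b', ?_, hc'⟩⟩
          have := ψ.map_mul _ _ _ _ hb hb'
          simpa only [← mul_assoc, mul_inv_mul] using this
      ran_ideal := by
        rintro c ⟨a, hc⟩ x
        obtain ⟨b, hb, hc⟩ := (PEquiv.mem_trans _ _ _ _).1 hc
        constructor
        · obtain ⟨b', hb'⟩ := (φ.ran_ideal _ (φ.ran_ideal c ⟨b, hc⟩ x).1 c⁻¹).2
          obtain ⟨a', ha'⟩ := (ψ.ran_ideal b ⟨a, hb⟩ b').1
          refine ⟨a', (PEquiv.mem_trans _ _ _ _).2 ⟨b' * b, ha', ?_⟩⟩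
          have := φ.map_mul _ _ _ _ hb' hc
          simpa only [mul_assoc, mul_inv_mul'] using this
        · obtain ⟨b', hb'⟩ := (φ.ran_ideal _ (φ.ran_ideal c ⟨b, hc⟩ x).2 c⁻¹).1
          obtain ⟨a', ha'⟩ := (ψ.ran_ideal b ⟨a, hb⟩ b').2
          refine ⟨a', (PEquiv.mem_trans _ _ _ _).2 ⟨b * b', ha', ?_⟩⟩
          have := φ.map_mul _ _ _ _ hc hb'
          simpa only [← mul_assoc, mul_inv_mul] using this
      map_mul := by
        intro a a' c c' h h'
        obtain ⟨b, hb, hc⟩ := (PEquiv.mem_trans _ _ _ _).1 h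
        obtain ⟨b', hb', hc'⟩ := (PEquiv.mem_trans _ _ _ _).1 h'
        exact (PEquiv.mem_trans _ _ _ _).2
          ⟨b * b', ψ.map_mul _ _ _ _ hb hb', φ.map_mul _ _ _ _ hc hc'⟩ }
  one :=
    { toPEquiv := PEquiv.refl A
      dom_ideal := fun _ _ _ => ⟨⟨_, rfl⟩, ⟨_, rfl⟩⟩
      ran_ideal := fun _ _ _ => ⟨⟨_, rfl⟩, ⟨_, rfl⟩⟩
      map_mul := by
        intro a a' b b' h h'
        cases h
        cases h'
        rfl }
  mul_assoc φ ψ χ := by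
    apply IdealIso.ext
    exact (PEquiv.trans_assoc _ _ _).symm
  one_mul φ := by
    apply IdealIso.ext
    exact PEquiv.trans_refl _
  mul_one φ := by
    apply IdealIso.ext
    exact PEquiv.refl_trans _

theorem mem_mul {φ ψ : IdealIso A} {a c : A} :
    c ∈ (φ * ψ).toPEquiv a ↔ ∃ b, b ∈ ψ.toPEquiv a ∧ c ∈ φ.toPEquiv b :=
  PEquiv.mem_trans _ _ _ _

/-! A multiplier of an ideal `R` maps every ideal contained in `R` to itself. -/

theorem left_mem {R : Subsemigroup A} (hR : IsTwoSidedIdeal (R : Set A)) {J : Set A}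
    (hJ : IsTwoSidedIdeal J) (m : Multiplier R) (b : R) (hb : (b : A) ∈ J) :
    (m.left b : A) ∈ J := by
  have h1 : (b : A) * (b : A)⁻¹ ∈ R := (hR b b.2 _).2
  have h2 : b = ⟨_, h1⟩ * b := Subtype.ext (mul_inv_mul (b : A)).symm
  rw [h2, m.left_mul]
  exact (hJ b hb _).1

theorem right_mem {R : Subsemigroup A} (hR : IsTwoSidedIdeal (R : Set A)) {J : Set A}
    (hJ : IsTwoSidedIdeal J) (m : Multiplier R) (b : R) (hb : (b : A) ∈ J) :
    (m.right b : A) ∈ J := by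
  have h1 : (b : A)⁻¹ * (b : A) ∈ R := (hR b b.2 _).1
  have h2 : b = b * ⟨_, h1⟩ := Subtype.ext (mul_inv_mul' (b : A)).symm
  rw [h2, m.mul_right]
  exact (hJ b hb _).2

theorem conj_mem {R : Subsemigroup A} (hR : IsTwoSidedIdeal (R : Set A)) {J : Set A}
    (hJ : IsTwoSidedIdeal J) (m : (Multiplier R)ˣ) (b : R) (hb : (b : A) ∈ J) :
    ((Multiplier.conj m b : R) : A) ∈ J :=
  right_mem hR hJ _ _ (left_mem hR hJ _ _ hb)

/-- Restriction of multipliers of an ideal `R` to an ideal contained in `R`. -/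
def restrict {R J : Subsemigroup A} (hR : IsTwoSidedIdeal (R : Set A))
    (hJ : IsTwoSidedIdeal (J : Set A)) (h : J ≤ R) : Multiplier R →* Multiplier J where
  toFun m :=
    { left := fun x => ⟨m.left ⟨x, h x.2⟩, left_mem hR hJ m _ x.2⟩
      right := fun x => ⟨m.right ⟨x, h x.2⟩, right_mem hR hJ m _ x.2⟩
      left_mul := fun s t => by
        have := congrArg Subtype.val (m.left_mul ⟨s, h s.2⟩ ⟨t, h t.2⟩)
        exact Subtype.ext this
      mul_right := fun s t => by
        have := congrArg Subtype.val (m.mul_right ⟨s, h s.2⟩ ⟨t, h t.2⟩)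
        exact Subtype.ext this
      mul_left := fun s t => by
        have := congrArg Subtype.val (m.mul_left ⟨s, h s.2⟩ ⟨t, h t.2⟩)
        exact Subtype.ext this }
  map_one' := rfl
  map_mul' _ _ := rfl

theorem sim_refl (φ : IdealIso A) : Sim φ φ := ⟨rfl, rfl, 1, fun _ _ h => h⟩

theorem conj_conj_inv {S : Type*} [Semigroup S] (hS : ∀ s : S, ∃ t u, s = t * u)
    (m : (Multiplier S)ˣ) (s : S) : Multiplier.conj m⁻¹ (Multiplier.conj m s) = s := by
  have key : ∀ (m n : Multiplier S) (s : S), m.left (n.right s) = n.right (m.left s) := by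
    intro m n s
    obtain ⟨t, u, rfl⟩ := hS s
    rw [n.mul_right, m.left_mul, m.left_mul, n.mul_right]
  have hl : ∀ s, (m⁻¹).val.left (m.val.left s) = s := fun s =>
    congrFun (congrArg Multiplier.left m.inv_mul) s
  have hr : ∀ s, m.val.right ((m⁻¹).val.right s) = s := fun s =>
    congrFun (congrArg Multiplier.right m.inv_mul) s
  unfold Multiplier.conj
  rw [inv_inv, key, hl, hr]

theorem conj_mul {S : Type*} [Semigroup S] (hS : ∀ s : S, ∃ t u, s = t * u)
    (m n : (Multiplier S)ˣ) (s : S) :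
    Multiplier.conj (m * n) s = Multiplier.conj m (Multiplier.conj n s) := by
  have key : ∀ (m n : Multiplier S) (s : S), m.left (n.right s) = n.right (m.left s) := by
    intro m n s
    obtain ⟨t, u, rfl⟩ := hS s
    rw [n.mul_right, m.left_mul, m.left_mul, n.mul_right]
  unfold Multiplier.conj
  rw [mul_inv_rev, key]
  rfl

theorem ideal_factor {R : Subsemigroup A} (hR : IsTwoSidedIdeal (R : Set A)) (s : R) :
    ∃ t u : R, s = t * u :=
  ⟨⟨_, (hR s s.2 (s : A)⁻¹).2⟩, s, Subtype.ext (mul_inv_mul (s : A)).symm⟩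

theorem sim_of_eq {ψ φ : IdealIso A} (hd : φ.dom = ψ.dom) {R : Subsemigroup A}
    (h : φ.ran = R) (h' : ψ.ran = R)
    (hm : ∃ m : (Multiplier R)ˣ, ∀ (s : A) (t : R), (t : A) ∈ φ.toPEquiv s →
      ((Multiplier.conj m t : R) : A) ∈ ψ.toPEquiv s) : Sim ψ φ := by
  subst h
  exact ⟨hd, h'.symm, hm⟩

theorem sim_ran {ψ φ : IdealIso A} (hs : Sim ψ φ) {R : Subsemigroup A} (h : φ.ran = R) :
    ∃ m : (Multiplier R)ˣ, ∀ (s : A) (t : R), (t : A) ∈ φ.toPEquiv s →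
      ((Multiplier.conj m t : R) : A) ∈ ψ.toPEquiv s := by
  subst h
  exact hs.2.2

theorem sim_symm {ψ φ : IdealIso A} (h : Sim ψ φ) : Sim φ ψ := by
  obtain ⟨hd, hr, m, hm⟩ := h
  refine sim_of_eq hd.symm hr.symm rfl ⟨m⁻¹, ?_⟩
  intro s t ht
  have hs : s ∈ φ.dom := hd ▸ (⟨_, ht⟩ : s ∈ ψ.dom)
  obtain ⟨b, hb⟩ := hs
  have h1 := hm s ⟨b, ⟨s, hb⟩⟩ hb
  have h2 : t = Multiplier.conj m ⟨b, ⟨s, hb⟩⟩ := Subtype.ext (ψ.val_unique ht h1)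
  rw [h2, conj_conj_inv (ideal_factor φ.ran_ideal)]
  exact hb

theorem sim_trans {χ ψ φ : IdealIso A} (h : Sim χ ψ) (h' : Sim ψ φ) : Sim χ φ := by
  obtain ⟨n, hn⟩ := sim_ran h h'.2.1.symm
  obtain ⟨hd, hr, m, hm⟩ := h'
  refine ⟨hd.trans h.1, hr.trans h.2.1, n * m, ?_⟩
  intro s t ht
  rw [conj_mul (ideal_factor φ.ran_ideal)]
  exact hn s _ (hm s t ht)

theorem sim_mul_right {ψ φ : IdealIso A} (h : Sim ψ φ) (α : IdealIso A) :
    Sim (ψ * α) (φ * α) := by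
  have hran : ∀ {ψ φ : IdealIso A}, Sim ψ φ → (ψ * α).ran ≤ (φ * α).ran := by
    rintro ψ φ ⟨hd, hr, m, hm⟩ b ⟨a, ha⟩
    obtain ⟨c, hc, hb⟩ := mem_mul.1 ha
    have hs : c ∈ φ.dom := hd ▸ (⟨_, hb⟩ : c ∈ ψ.dom)
    obtain ⟨d, hd'⟩ := hs
    have h1 := hm c ⟨d, ⟨c, hd'⟩⟩ hd'
    rw [ψ.val_unique hb h1]
    exact conj_mem φ.ran_ideal (φ * α).ran_ideal m _ ⟨a, mem_mul.2 ⟨c, hc, hd'⟩⟩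
  have hle : (φ * α).ran ≤ φ.ran := by
    rintro b ⟨a, ha⟩
    obtain ⟨c, hc, hb⟩ := mem_mul.1 ha
    exact ⟨c, hb⟩
  have hr := le_antisymm (hran (sim_symm h)) (hran h)
  obtain ⟨hd, -, m, hm⟩ := h
  refine ⟨?_, hr, Units.map (restrict φ.ran_ideal (φ * α).ran_ideal hle) m, ?_⟩
  · ext a
    have hd' : ∀ b, (∃ c, c ∈ φ.toPEquiv b) ↔ ∃ c, c ∈ ψ.toPEquiv b := fun b =>
      SetLike.ext_iff.1 hd b
    simp only [mem_dom, mem_mul]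
    constructor
    · rintro ⟨c, b, hb, hc⟩
      obtain ⟨c', hc'⟩ := (hd' b).1 ⟨c, hc⟩
      exact ⟨c', b, hb, hc'⟩
    · rintro ⟨c, b, hb, hc⟩
      obtain ⟨c', hc'⟩ := (hd' b).2 ⟨c, hc⟩
      exact ⟨c', b, hb, hc'⟩
  · intro s t ht
    obtain ⟨c, hc, hb⟩ := mem_mul.1 ht
    exact mem_mul.2 ⟨c, hc, hm c ⟨t, ⟨c, hb⟩⟩ hb⟩

theorem sim_mul_left {ψ φ : IdealIso A} (h : Sim ψ φ) (α : IdealIso A) :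
    Sim (α * ψ) (α * φ) := by
  have hdom : ∀ {ψ φ : IdealIso A}, Sim ψ φ → (α * φ).dom ≤ (α * ψ).dom := by
    rintro ψ φ ⟨hd, hr, m, hm⟩ a ⟨c, hc⟩
    obtain ⟨b, hb, hc⟩ := mem_mul.1 hc
    have h1 := hm a ⟨b, ⟨a, hb⟩⟩ hb
    obtain ⟨d, hd⟩ := conj_mem φ.ran_ideal α.dom_ideal m ⟨b, ⟨a, hb⟩⟩ ⟨c, hc⟩
    exact ⟨d, mem_mul.2 ⟨_, h1, hd⟩⟩
  have hran : ∀ {ψ φ : IdealIso A}, Sim ψ φ → (α * φ).ran ≤ (α * ψ).ran := by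
    rintro ψ φ ⟨hd, hr, -⟩ c ⟨a, hc⟩
    obtain ⟨b, hb, hc⟩ := mem_mul.1 hc
    have hb' : b ∈ ψ.ran := hr ▸ (⟨_, hb⟩ : b ∈ φ.ran)
    obtain ⟨a', ha'⟩ := hb'
    exact ⟨a', mem_mul.2 ⟨b, ha', hc⟩⟩
  have hJ : IsTwoSidedIdeal ((φ.ran ⊓ α.dom : Subsemigroup A) : Set A) := fun a ha x =>
    ⟨⟨(φ.ran_ideal a ha.1 x).1, (α.dom_ideal a ha.2 x).1⟩,
      ⟨(φ.ran_ideal a ha.1 x).2, (α.dom_ideal a ha.2 x).2⟩⟩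
  have hex : ∀ x : (φ.ran ⊓ α.dom : Subsemigroup A), ∃ y : (α * φ).ran,
      (y : A) ∈ α.toPEquiv x := by
    rintro ⟨x, ⟨a, ha⟩, ⟨y, hy⟩⟩
    exact ⟨⟨y, a, mem_mul.2 ⟨x, ha, hy⟩⟩, hy⟩
  choose f hf using hex
  have hbij : Function.Bijective f := by
    constructor
    · intro x y hxy
      have h1 := hf x
      rw [hxy] at h1
      exact Subtype.ext (α.toPEquiv.inj h1 (hf y))
    · rintro ⟨y, a, hy⟩
      obtain ⟨b, hb, hc⟩ := mem_mul.1 hy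
      exact ⟨⟨b, ⟨a, hb⟩, ⟨y, hc⟩⟩, Subtype.ext (α.val_unique (hf _) hc)⟩
  let fe : (φ.ran ⊓ α.dom : Subsemigroup A) ≃* (α * φ).ran :=
    { Equiv.ofBijective f hbij with
      map_mul' := fun x y => Subtype.ext
        (α.val_unique (hf (x * y)) (α.map_mul _ _ _ _ (hf x) (hf y))) }
  have hfe : ∀ x, fe x = f x := fun _ => rfl
  have hs := h
  obtain ⟨-, -, m, hm⟩ := h
  refine ⟨le_antisymm (hdom hs) (hdom (sim_symm hs)), le_antisymm (hran hs) (hran (sim_symm hs)),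
    Units.map ((Multiplier.transport fe).comp (restrict φ.ran_ideal hJ inf_le_left)) m, ?_⟩
  intro s t ht
  obtain ⟨b, hb, hc⟩ := mem_mul.1 ht
  have hbJ : b ∈ (φ.ran ⊓ α.dom : Subsemigroup A) := ⟨⟨s, hb⟩, ⟨t, hc⟩⟩
  have h1 : fe.symm t = ⟨b, hbJ⟩ := by
    rw [MulEquiv.symm_apply_eq, hfe]
    exact Subtype.ext (α.val_unique hc (hf ⟨b, hbJ⟩))
  have h2 : Multiplier.conj
      (Units.map ((Multiplier.transport fe).comp (restrict φ.ran_ideal hJ inf_le_left)) m) t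
      = fe (Multiplier.conj (Units.map (restrict φ.ran_ideal hJ inf_le_left) m) ⟨b, hbJ⟩) := by
    have key : ∀ (p q : Multiplier (φ.ran ⊓ α.dom : Subsemigroup A)) (t : (α * φ).ran),
        (Multiplier.transport fe q).right ((Multiplier.transport fe p).left t)
          = fe (q.right (p.left (fe.symm t))) := by
      intro p q t
      change fe (q.right (fe.symm (fe (p.left (fe.symm t))))) = _
      rw [fe.symm_apply_apply]
    rw [← h1]
    exact key _ _ t
  rw [h2]
  exact mem_mul.2 ⟨_, hm s ⟨b, ⟨s, hb⟩⟩ hb,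
    hf (Multiplier.conj (Units.map (restrict φ.ran_ideal hJ inf_le_left) m) ⟨b, hbJ⟩)⟩

/-- The relation `∼` is a congruence on `Σ(A)`. -/
def simCon (A : Type*) [InverseSemigroup A] : Con (IdealIso A) where
  r := Sim
  iseqv := ⟨sim_refl, sim_symm, sim_trans⟩
  mul' := fun {_ _ _ _} h h' => sim_trans (sim_mul_right h _) (sim_mul_left h' _)

end IdealIso

/-- The monoid `ς(A) = Σ(A)/∼`. -/
def Varsigma (A : Type*) [InverseSemigroup A] : Type _ := (IdealIso.simCon A).Quotient

instance (A : Type*) [InverseSemigroup A] : Monoid (Varsigma A) :=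
  inferInstanceAs (Monoid (IdealIso.simCon A).Quotient)

/-- The class `[φ]` in `ς(A)` of an isomorphism `φ` between ideals of `A`. -/
def Varsigma.mk {A : Type*} [InverseSemigroup A] (φ : IdealIso A) : Varsigma A :=
  (φ : (IdealIso.simCon A).Quotient)

/-- Unital partial homomorphisms from a group to a monoid. -/
structure IsUnitalPartialHom {G M : Type*} [Group G] [Monoid M] (f : G → M) : Prop where
  map_one : f 1 = 1
  left : ∀ g h : G, f g⁻¹ * f g * f h = f g⁻¹ * f (g * h)
  right : ∀ g h : G, f g * f h * f h⁻¹ = f (g * h) * f h⁻¹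

/-! ### Extensions, order-preserving transversals and the induced maps `θ_g` -/

/-- An extension `A → U → S` of a semilattice of groups `A` by an inverse semigroup `S`: `U` is an
inverse semigroup, `i` is a monomorphism, `j` is an idempotent-separating epimorphism, and
`i(A) = j⁻¹(E(S))`. -/
structure Extension (A U S : Type*) [SemilatticeOfGroups A] [InverseSemigroup U]
    [InverseSemigroup S] where
  i : A →ₙ* U
  j : U →ₙ* S
  i_injective : Function.Injective i
  j_surjective : Function.Surjective j
  j_separating : ∀ e f : U, IsIdempotentElem e → IsIdempotentElem f → j e = j f → e = f
  range_i : Set.range i = {u : U | IsIdempotentElem (j u)}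

section Ext

variable {A U S : Type*} [SemilatticeOfGroups A] [InverseSemigroup U] [InverseSemigroup S]

/-- An order-preserving transversal `ρ : S → U` of `j`: a section of `j` that maps idempotents to
idempotents and preserves the natural partial orders. -/
structure OrderPreservingTransversal (E : Extension A U S) where
  ρ : S → U
  j_ρ : ∀ s : S, E.j (ρ s) = s
  ρ_idem : ∀ e : S, IsIdempotentElem e → IsIdempotentElem (ρ e)
  ρ_mono : ∀ s t : S, NatLE s t → NatLE (ρ s) (ρ t)

namespace Extension

variable (E : Extension A U S)

theorem exists_of_idem {u : U} (h : IsIdempotentElem (E.j u)) : ∃ a : A, E.i a = u :=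
  E.range_i.symm.subset h

theorem j_i_idem (a : A) : IsIdempotentElem (E.j (E.i a)) :=
  E.range_i.subset ⟨a, rfl⟩

theorem j_conj_idem (u : U) (a : A) : IsIdempotentElem (E.j (u * E.i a * u⁻¹)) := by
  rw [map_mul, map_mul, map_inv']
  exact idem_conj (E.j_i_idem a) _

/-- The endomorphism `ν_u(a) = i⁻¹(u i(a) u⁻¹)` of `A`. -/
noncomputable def nu (u : U) (a : A) : A :=
  Classical.choose (E.exists_of_idem (E.j_conj_idem u a))

theorem i_nu (u : U) (a : A) : E.i (E.nu u a) = u * E.i a * u⁻¹ :=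
  Classical.choose_spec (E.exists_of_idem (E.j_conj_idem u a))

theorem j_i_mul_inv (a : A) : E.j (E.i (a * a⁻¹)) = E.j (E.i a) := by
  rw [map_mul, map_mul, map_inv', map_inv', idem_inv (E.j_i_idem a), (E.j_i_idem a).eq]

theorem j_i_inv_mul (a : A) : E.j (E.i (a⁻¹ * a)) = E.j (E.i a) := by
  rw [map_mul, map_mul, map_inv', map_inv', idem_inv (E.j_i_idem a), (E.j_i_idem a).eq]

end Extension

namespace OrderPreservingTransversal

variable {E : Extension A U S} (T : OrderPreservingTransversal E)

theorem j_ρ_idem (e : {e : S // IsIdempotentElem e}) : IsIdempotentElem (E.j (T.ρ e)) := by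
  rw [T.j_ρ]
  exact e.2

/-- The map `α(e) = i⁻¹(ρ(e))`, defined for idempotents `e` of `S`. -/
noncomputable def alpha (e : {e : S // IsIdempotentElem e}) : A :=
  Classical.choose (E.exists_of_idem (T.j_ρ_idem e))

theorem i_alpha (e : {e : S // IsIdempotentElem e}) : E.i (T.alpha e) = T.ρ e :=
  Classical.choose_spec (E.exists_of_idem (T.j_ρ_idem e))

/-- The endomorphism `λ_s = ν_{ρ(s)}` of `A`. -/
noncomputable def lam (s : S) (a : A) : A := E.nu (T.ρ s) a

theorem i_lam (s : S) (a : A) : E.i (T.lam s a) = T.ρ s * E.i a * (T.ρ s)⁻¹ := E.i_nu _ _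

/-- The graph of `θ_g`: `θ_g(a) = b` iff `b = λ_s(a)` for some `s ∈ g` with
`α(s⁻¹s) = aa⁻¹`. -/
def ThetaRel (g : MaxGroupImage S) (a b : A) : Prop :=
  ∃ s : S, toMaxGroup s = g ∧ T.alpha ⟨s⁻¹ * s, idem_inv_mul s⟩ = a * a⁻¹ ∧ T.lam s a = b

theorem alpha_eq_iff (e : {e : S // IsIdempotentElem e}) (a : A) :
    T.alpha e = a * a⁻¹ ↔ (e : S) = E.j (E.i a) := by
  rw [← E.j_i_mul_inv, ← E.i_injective.eq_iff, T.i_alpha]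
  constructor
  · intro h
    rw [← h, T.j_ρ]
  · intro h
    refine E.j_separating _ _ (T.ρ_idem _ e.2) ?_ (by rw [T.j_ρ, h])
    rw [map_mul, map_inv']
    exact idem_mul_inv _

theorem thetaRel_iff {g : MaxGroupImage S} {a b : A} :
    T.ThetaRel g a b ↔ ∃ s : S, toMaxGroup s = g ∧ s⁻¹ * s = E.j (E.i a) ∧
      E.i b = T.ρ s * E.i a * (T.ρ s)⁻¹ := by
  unfold ThetaRel
  refine exists_congr fun s => and_congr_right fun _ => and_congr ?_ ?_
  · rw [T.alpha_eq_iff]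
  · rw [← T.i_lam, E.i_injective.eq_iff, eq_comm]

theorem ρ_dom (s : S) (a : A) (h : s⁻¹ * s = E.j (E.i a)) :
    (T.ρ s)⁻¹ * T.ρ s = E.i (a * a⁻¹) := by
  refine E.j_separating _ _ (idem_inv_mul _) ?_ ?_
  · rw [map_mul, map_inv']
    exact idem_mul_inv _
  · rw [E.j_i_mul_inv, map_mul, map_inv', T.j_ρ, h]

theorem ran_eq {s : S} {a b : A} (h : s⁻¹ * s = E.j (E.i a))
    (hb : E.i b = T.ρ s * E.i a * (T.ρ s)⁻¹) : s * s⁻¹ = E.j (E.i b) := by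
  rw [hb, map_mul, map_mul, map_inv', T.j_ρ, ← h, ← mul_assoc, mul_inv_mul]

theorem back {s : S} {a b : A} (h : s⁻¹ * s = E.j (E.i a))
    (hb : E.i b = T.ρ s * E.i a * (T.ρ s)⁻¹) :
    E.i a = (T.ρ s)⁻¹ * E.i b * T.ρ s := by
  have h1 := T.ρ_dom s a h
  calc E.i a = E.i (a * a⁻¹) * E.i a * E.i (a * a⁻¹) := by
        rw [← map_mul, ← map_mul, mul_inv_mul, SemilatticeOfGroups.mul_inv_eq_inv_mul,
          mul_inv_mul']
    _ = (T.ρ s)⁻¹ * E.i b * T.ρ s := by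
        rw [← h1, hb]
        simp only [mul_assoc]

theorem thetaRel_fun (hS : IsEUnitary S) {g : MaxGroupImage S} {a b c : A}
    (h : T.ThetaRel g a b) (h' : T.ThetaRel g a c) : b = c := by
  rw [thetaRel_iff] at h h'
  obtain ⟨s, hs, hd, hb⟩ := h
  obtain ⟨t, ht, hd', hc⟩ := h'
  obtain rfl := eq_of_dom_eq hS (hs.trans ht.symm) (hd.trans hd'.symm)
  exact E.i_injective (hb.trans hc.symm)

theorem thetaRel_inj (hS : IsEUnitary S) {g : MaxGroupImage S} {a b c : A}
    (h : T.ThetaRel g a c) (h' : T.ThetaRel g b c) : a = b := by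
  rw [thetaRel_iff] at h h'
  obtain ⟨s, hs, hd, hb⟩ := h
  obtain ⟨t, ht, hd', hc⟩ := h'
  obtain rfl := eq_of_ran_eq hS (hs.trans ht.symm) ((T.ran_eq hd hb).trans (T.ran_eq hd' hc).symm)
  exact E.i_injective ((T.back hd hb).trans (T.back hd' hc).symm)

theorem thetaRel_dom {g : MaxGroupImage S} {a : A} :
    (∃ b, T.ThetaRel g a b) ↔ ∃ s : S, toMaxGroup s = g ∧ s⁻¹ * s = E.j (E.i a) := by
  simp only [thetaRel_iff]
  constructor
  · rintro ⟨b, s, hs, h, -⟩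
    exact ⟨s, hs, h⟩
  · rintro ⟨s, hs, h⟩
    exact ⟨T.lam s a, s, hs, h, T.i_lam s a⟩

theorem thetaRel_ran {g : MaxGroupImage S} {b : A} :
    (∃ a, T.ThetaRel g a b) ↔ ∃ s : S, toMaxGroup s = g ∧ s * s⁻¹ = E.j (E.i b) := by
  simp only [thetaRel_iff]
  constructor
  · rintro ⟨a, s, hs, h, hb⟩
    exact ⟨s, hs, T.ran_eq h hb⟩
  · rintro ⟨s, hs, h⟩
    have hr : T.ρ s * (T.ρ s)⁻¹ = E.i (b * b⁻¹) := by
      refine E.j_separating _ _ (idem_mul_inv _) ?_ ?_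
      · rw [map_mul, map_inv']
        exact idem_mul_inv _
      · rw [E.j_i_mul_inv, map_mul, map_inv', T.j_ρ, h]
    refine ⟨E.nu (T.ρ s)⁻¹ b, s, hs, ?_, ?_⟩
    · rw [E.i_nu, inv_inv', map_mul, map_mul, map_inv', T.j_ρ, ← h]
      simp only [mul_assoc, inv_mul_cancel_mul]
    · rw [E.i_nu, inv_inv']
      calc E.i b = E.i (b * b⁻¹) * E.i b * E.i (b * b⁻¹) := by
            rw [← map_mul, ← map_mul, mul_inv_mul, SemilatticeOfGroups.mul_inv_eq_inv_mul,
              mul_inv_mul']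
        _ = T.ρ s * ((T.ρ s)⁻¹ * E.i b * T.ρ s) * (T.ρ s)⁻¹ := by
            rw [← hr]
            simp only [mul_assoc]

theorem thetaRel_dom_ideal (g : MaxGroupImage S) :
    IsTwoSidedIdeal {a : A | ∃ b, T.ThetaRel g a b} := by
  intro a ha x
  simp only [Set.mem_ofPred_eq, thetaRel_dom] at ha ⊢
  obtain ⟨s, hs, h⟩ := ha
  have hx := E.j_i_idem x
  have ha := E.j_i_idem a
  have hc := idem_comm ha hx
  have key : (s * E.j (E.i x))⁻¹ * (s * E.j (E.i x)) = E.j (E.i a) * E.j (E.i x) := by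
    rw [mul_inv_rev', idem_inv hx]
    calc E.j (E.i x) * s⁻¹ * (s * E.j (E.i x)) = E.j (E.i x) * (s⁻¹ * s) * E.j (E.i x) := by
          simp only [mul_assoc]
      _ = _ := by rw [h, ← hc, mul_assoc, hx.eq]
  have hg : toMaxGroup (s * E.j (E.i x)) = g := by
    rw [← hs]
    exact toMaxGroup_of_le (natLE_mul_idem hx s)
  refine ⟨⟨_, hg, ?_⟩, ⟨_, hg, ?_⟩⟩
  · rw [key, map_mul, map_mul, hc]
  · rw [key, map_mul, map_mul]

theorem thetaRel_ran_ideal (g : MaxGroupImage S) :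
    IsTwoSidedIdeal {b : A | ∃ a, T.ThetaRel g a b} := by
  intro a ha x
  simp only [Set.mem_ofPred_eq, thetaRel_ran] at ha ⊢
  obtain ⟨s, hs, h⟩ := ha
  have hx := E.j_i_idem x
  have ha := E.j_i_idem a
  have hc := idem_comm ha hx
  have key : (E.j (E.i x) * s) * (E.j (E.i x) * s)⁻¹ = E.j (E.i a) * E.j (E.i x) := by
    rw [mul_inv_rev', idem_inv hx]
    calc E.j (E.i x) * s * (s⁻¹ * E.j (E.i x)) = E.j (E.i x) * (s * s⁻¹) * E.j (E.i x) := by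
          simp only [mul_assoc]
      _ = _ := by rw [h, ← hc, mul_assoc, hx.eq]
  have hg : toMaxGroup (E.j (E.i x) * s) = g := by
    rw [← hs]
    exact toMaxGroup_of_le ⟨_, hx, rfl⟩
  refine ⟨⟨_, hg, ?_⟩, ⟨_, hg, ?_⟩⟩
  · rw [key, map_mul, map_mul, hc]
  · rw [key, map_mul, map_mul]

theorem thetaRel_mul (hS : IsEUnitary S) {g : MaxGroupImage S} {a a' b b' : A}
    (h : T.ThetaRel g a b) (h' : T.ThetaRel g a' b') : T.ThetaRel g (a * a') (b * b') := by
  obtain ⟨c, hc⟩ := (T.thetaRel_dom_ideal g a' ⟨b', h'⟩ a).1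
  have hcc := hc
  rw [thetaRel_iff] at h h' hc
  obtain ⟨s, hs, hd, hb⟩ := h
  obtain ⟨t, ht, hd', hb'⟩ := h'
  obtain ⟨r, hr, hdr, hcr⟩ := hc
  have hpa := E.j_i_idem a
  have hpa' := E.j_i_idem a'
  have hrs : r = s * E.j (E.i a') := by
    apply eq_of_dom_eq hS
    · rw [hr, ← hs]
      exact (toMaxGroup_of_le (natLE_mul_idem hpa' s)).symm
    · rw [hdr, mul_inv_rev', idem_inv hpa', map_mul, map_mul]
      calc _ = E.j (E.i a') * E.j (E.i a) * E.j (E.i a') := by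
            rw [idem_comm hpa' hpa, mul_assoc, hpa'.eq]
        _ = _ := by rw [← hd]; simp only [mul_assoc]
  have hrt : r = t * E.j (E.i a) := by
    apply eq_of_dom_eq hS
    · rw [hr, ← ht]
      exact (toMaxGroup_of_le (natLE_mul_idem hpa t)).symm
    · rw [hdr, mul_inv_rev', idem_inv hpa, map_mul, map_mul]
      calc _ = E.j (E.i a) * E.j (E.i a') * E.j (E.i a) := by
            rw [idem_comm hpa hpa', mul_assoc, hpa.eq]
        _ = _ := by rw [← hd']; simp only [mul_assoc]
  -- `r = s s⁻¹ t`, so that `r r⁻¹ = s s⁻¹ t t⁻¹`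
  have hst : r = s * s⁻¹ * t := by
    have hi := (compat_of_eq hS (hs.trans ht.symm)).1
    have h2 : s⁻¹ * t = t⁻¹ * s := by
      have := idem_inv hi
      rwa [mul_inv_rev', inv_inv', eq_comm] at this
    have h4 := (compat_of_eq hS (hs.trans ht.symm)).2
    have h5 : s * t⁻¹ = t * s⁻¹ := by
      have := idem_inv h4
      rwa [mul_inv_rev', inv_inv', eq_comm] at this
    -- both are the meet of `s` and `t`
    have h6 : s * s⁻¹ * t = s * (t⁻¹ * s) := by rw [mul_assoc, h2]
    have h7 : s * (t⁻¹ * s) = t * (s⁻¹ * s) := by rw [← mul_assoc, h5, mul_assoc]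
    rw [h6, h7, hd, hrt]
  have hran : r * r⁻¹ = s * s⁻¹ * (t * t⁻¹) := by
    rw [hst, mul_inv_rev', mul_inv_rev', inv_inv']
    calc s * s⁻¹ * t * (t⁻¹ * (s * s⁻¹)) = s * s⁻¹ * ((t * t⁻¹) * (s * s⁻¹)) := by
          simp only [mul_assoc]
      _ = s * s⁻¹ * (t * t⁻¹) := by
          rw [idem_comm (idem_mul_inv t) (idem_mul_inv s), ← mul_assoc, (idem_mul_inv s).eq]
  have hls : NatLE (T.ρ r) (T.ρ s) := T.ρ_mono _ _ (hrs ▸ natLE_mul_idem hpa' s)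
  have hlt : NatLE (T.ρ r) (T.ρ t) := T.ρ_mono _ _ (hrt ▸ natLE_mul_idem hpa t)
  have hk : T.ρ r * (T.ρ r)⁻¹ = E.i ((b * b') * (b * b')⁻¹) := by
    refine E.j_separating _ _ (idem_mul_inv _) ?_ ?_
    · rw [map_mul, map_inv']
      exact idem_mul_inv _
    · rw [E.j_i_mul_inv, map_mul, map_inv', T.j_ρ, hran, map_mul, map_mul, T.ran_eq hd hb,
        T.ran_eq hd' hb']
  have hfin : c = b * b' := by
    apply E.i_injective
    have e1 := natLE_left hls
    have e2 := natLE_left hlt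
    set u := T.ρ r with hu
    set v := T.ρ s with hv
    set w := T.ρ t with hw
    -- idempotents of `i(A)` commute with `i(A)`
    have hcen : ∀ (e : U) (x : A), IsIdempotentElem e → e * E.i x = E.i x * e := by
      intro e x he
      obtain ⟨y, rfl⟩ := E.exists_of_idem (u := e) (by
        unfold IsIdempotentElem
        rw [← map_mul, he.eq])
      have hy : IsIdempotentElem y := E.i_injective (by rw [map_mul]; exact he)
      rw [← map_mul, ← map_mul]
      congr 1
      exact idem_central hy x
    have hki := idem_mul_inv u
    have hdi := idem_inv_mul u
    calc E.i c = u * (E.i a * E.i a') * u⁻¹ := by rw [hcr, map_mul]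
      _ = u * (u⁻¹ * u * E.i a) * E.i a' * u⁻¹ := by
          simp only [mul_assoc, mul_inv_cancel_mul]
      _ = u * E.i a * u⁻¹ * (u * E.i a' * u⁻¹) := by
          rw [hcen _ _ hdi]; simp only [mul_assoc]
      _ = (u * u⁻¹ * (v * E.i a * v⁻¹) * (u * u⁻¹))
            * (u * u⁻¹ * (w * E.i a' * w⁻¹) * (u * u⁻¹)) := by
          have p1 : u⁻¹ = v⁻¹ * (u * u⁻¹) := by
            have := congrArg (·⁻¹) e1
            simpa only [mul_inv_rev', inv_inv'] using this
          have p2 : u⁻¹ = w⁻¹ * (u * u⁻¹) := by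
            have := congrArg (·⁻¹) e2
            simpa only [mul_inv_rev', inv_inv'] using this
          have p3 : u * E.i a * u⁻¹ = u * u⁻¹ * (v * E.i a * v⁻¹) * (u * u⁻¹) := by
            calc u * E.i a * u⁻¹ = (u * u⁻¹ * v) * E.i a * (v⁻¹ * (u * u⁻¹)) := by
                  rw [← e1, ← p1]
              _ = _ := by simp only [mul_assoc]
          have p4 : u * E.i a' * u⁻¹ = u * u⁻¹ * (w * E.i a' * w⁻¹) * (u * u⁻¹) := by
            calc u * E.i a' * u⁻¹ = (u * u⁻¹ * w) * E.i a' * (w⁻¹ * (u * u⁻¹)) := by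
                  rw [← e2, ← p2]
              _ = _ := by simp only [mul_assoc]
          rw [← p3, ← p4]
      _ = (u * u⁻¹) * (E.i b * E.i b') := by
          rw [← hb, ← hb', hcen _ b hki, hcen _ b' hki, ← hcen _ b hki]
          set k := u * u⁻¹ with hkdef
          calc k * E.i b * k * (E.i b' * k * k) = k * E.i b * (k * E.i b') * (k * k) := by
                simp only [mul_assoc]
            _ = k * (E.i b * E.i b' * k) * k := by
                rw [hcen k b' hki, hki.eq]; simp only [mul_assoc]
            _ = k * (k * (E.i b * E.i b')) * k := by rw [← map_mul, hcen k _ hki]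
            _ = k * (E.i b * E.i b') * k := by rw [← mul_assoc k k, hki.eq]
            _ = k * (E.i b * E.i b') := by
                rw [← map_mul, mul_assoc, ← hcen k _ hki, ← mul_assoc, hki.eq]
      _ = E.i (b * b') := by rw [hk, ← map_mul, ← map_mul, mul_inv_mul]
  rw [← hfin]
  exact hcc

open Classical in
/-- For an E-unitary inverse semigroup `S`, the isomorphism `θ_g` between ideals of `A` given by
`θ_g(a) = λ_s(a)`, where `s ∈ g` and `α(s⁻¹s) = aa⁻¹`. Its domain consists of the `a` for which such
an `s` exists. -/
noncomputable def theta (hS : IsEUnitary S) (g : MaxGroupImage S) : IdealIso A :=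
  have hmem : ∀ a b : A, b ∈ (if h : ∃ b, T.ThetaRel g a b then some h.choose else none) ↔
      T.ThetaRel g a b := by
    intro a b
    split_ifs with h
    · rw [Option.mem_some_iff]
      exact ⟨fun hb => hb ▸ h.choose_spec, fun hb => T.thetaRel_fun hS h.choose_spec hb⟩
    · exact ⟨fun hb => (Option.not_mem_none _ hb).elim, fun hb => (h ⟨b, hb⟩).elim⟩
  have hmem' : ∀ a b : A, a ∈ (if h : ∃ a, T.ThetaRel g a b then some h.choose else none) ↔
      T.ThetaRel g a b := by
    intro a b
    split_ifs with h
    · rw [Option.mem_some_iff]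
      exact ⟨fun hb => hb ▸ h.choose_spec, fun hb => T.thetaRel_inj hS h.choose_spec hb⟩
    · exact ⟨fun hb => (Option.not_mem_none _ hb).elim, fun hb => (h ⟨a, hb⟩).elim⟩
  { toPEquiv :=
      { toFun := fun a => if h : ∃ b, T.ThetaRel g a b then some h.choose else none
        invFun := fun b => if h : ∃ a, T.ThetaRel g a b then some h.choose else none
        inv := fun a b => (hmem' a b).trans (hmem a b).symm }
    dom_ideal := by
      have h := T.thetaRel_dom_ideal g
      have h' : {a : A | ∃ b, T.ThetaRel g a b} = {a : A | ∃ b, b ∈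
          (if h : ∃ b, T.ThetaRel g a b then some h.choose else none)} :=
        Set.ext fun a => exists_congr fun b => (hmem a b).symm
      rw [h'] at h
      exact h
    ran_ideal := by
      have h := T.thetaRel_ran_ideal g
      have h' : {b : A | ∃ a, T.ThetaRel g a b} = {b : A | ∃ a, b ∈
          (if h : ∃ b, T.ThetaRel g a b then some h.choose else none)} :=
        Set.ext fun b => exists_congr fun a => (hmem a b).symm
      rw [h'] at h
      exact h
    map_mul := fun a a' b b' h h' =>
      (hmem _ _).2 (T.thetaRel_mul hS ((hmem _ _).1 h) ((hmem _ _).1 h')) }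

/-- The defining property of `θ_g`. -/
theorem mem_theta (hS : IsEUnitary S) (g : MaxGroupImage S) (a b : A) :
    b ∈ (T.theta hS g).toPEquiv a ↔ T.ThetaRel g a b := by
  classical
  change b ∈ (if h : ∃ b, T.ThetaRel g a b then some h.choose else none) ↔ _
  split_ifs with h
  · rw [Option.mem_some_iff]
    exact ⟨fun hb => hb ▸ h.choose_spec, fun hb => T.thetaRel_fun hS h.choose_spec hb⟩
  · exact ⟨fun hb => (Option.not_mem_none _ hb).elim, fun hb => (h ⟨b, hb⟩).elim⟩

/-- The map `ψ : G(S) → ς(A)`, `g ↦ [θ_g]`. -/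
noncomputable def psi (hS : IsEUnitary S) (g : MaxGroupImage S) : Varsigma A :=
  Varsigma.mk (T.theta hS g)

end OrderPreservingTransversal

end Ext

end InverseExt

/-! Write $\mathcal D_g$ for the range of $\theta_g$ and $\mathcal D_{h^{-1}}$ for the domain of
$\theta_h$. Everything reduces to one comparison: up to $\sim$, the composite $\theta_g\theta_h$ is
the restriction of $\theta_{gh}$ to values in $\mathcal D_g$ (`sim_theta_mul`).

If $t\in h$ and $s\in g$ are composable, that is $s^{-1}s=tt^{-1}$, then $r=st\in gh$ has the range
of $s$, the domain of $t$, and $t=s^{-1}r$. So $\theta_g\theta_h$ conjugates by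
$\rho(s)\rho(s^{-1}r)$ where $\theta_{gh}$ conjugates by $\rho(r)$. The two differ by the factor
$w=\rho(s)\rho(s^{-1}r)\rho(r)^{-1}$, which lies in $i(A)$. Since $S$ is E-unitary, $s$ and $r$ are
determined by their classes and their common range, so $w$ is a function of the value $c$ of
$\theta_{gh}$, and indeed only of $cc^{-1}$. Since $\rho$ preserves order, $w(cx)=w(c)\,xx^{-1}$
(`TwistRel.mul_right`). This compatibility is what makes $c\mapsto w(c)c$, $c\mapsto cw(c)$ an
invertible multiplier of the ideal (`unitOfCocycle`), and conjugation by it turns $\theta_{gh}(a)$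
into $\theta_g\theta_h(a)$.

For $\theta_{gh}$, restricting values to $\mathcal D_g$ is the same as restricting arguments to
$\mathcal D_{h^{-1}}$ (`theta_mul_idOn`). Multiplying on the left by $\theta_{g^{-1}}$, whose domain
is $\mathcal D_g$, or on the right by $\theta_{h^{-1}}$, whose range is $\mathcal D_{h^{-1}}$,
absorbs the restriction and gives the two identities. Finally, $\theta_1$ is the identity map on the
nose. -/

namespace InverseExt

/-! ### Multipliers of an ideal given by cocycles -/

namespace Multiplier

/-- A function on an ideal `R` of a semilattice of groups that picks from the subgroup of each
element a group element, compatibly with the semilattice structure. -/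
structure IsCocycle {A : Type*} [SemilatticeOfGroups A] (R : Subsemigroup A) (w : R → A) :
    Prop where
  mul_inv : ∀ c, w c * (w c)⁻¹ = (c : A) * (c : A)⁻¹
  eq_mul_right : ∀ c d : R, ∀ x : A, (d : A) = c * x → w d = w c * (x * x⁻¹)
  eq_mul_left : ∀ c d : R, ∀ x : A, (d : A) = x * c → w d = w c * (x * x⁻¹)

section Cocycle

variable {A : Type*} [SemilatticeOfGroups A] {R : Subsemigroup A} {w : R → A}

theorem IsCocycle.inv (hw : IsCocycle R w) : IsCocycle R (fun c => (w c)⁻¹) where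
  mul_inv c := by
    rw [inv_inv', ← SemilatticeOfGroups.mul_inv_eq_inv_mul, hw.mul_inv]
  eq_mul_right c d x h := by
    rw [hw.eq_mul_right c d x h, mul_inv_rev', idem_inv (idem_mul_inv x),
      idem_central (idem_mul_inv x)]
  eq_mul_left c d x h := by
    rw [hw.eq_mul_left c d x h, mul_inv_rev', idem_inv (idem_mul_inv x),
      idem_central (idem_mul_inv x)]

theorem IsCocycle.mul_mul_inv (hw : IsCocycle R w) (c : R) :
    w c * ((c : A) * (c : A)⁻¹) = w c := by
  rw [← hw.mul_inv, SemilatticeOfGroups.mul_inv_eq_inv_mul, mul_inv_mul']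

/-- The multiplier `c ↦ w(c) c`, `c ↦ c w(c)` of an ideal. -/
def ofCocycle (hR : IsTwoSidedIdeal (R : Set A)) (hw : IsCocycle R w) : Multiplier R where
  left c := ⟨w c * c, (hR c c.2 _).1⟩
  right c := ⟨c * w c, (hR c c.2 _).2⟩
  left_mul s t := by
    apply Subtype.ext
    change w (s * t) * ((s : A) * t) = w s * s * t
    rw [hw.eq_mul_right s (s * t) t rfl]
    calc w s * ((t : A) * (t : A)⁻¹) * (s * t) = w s * ((t : A) * (t : A)⁻¹ * s) * t := by
          simp only [mul_assoc]
      _ = w s * (s * ((t : A) * (t : A)⁻¹ * t)) := by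
          rw [idem_central (idem_mul_inv (t : A))]
          simp only [mul_assoc]
      _ = _ := by rw [mul_inv_mul, mul_assoc]
  mul_right s t := by
    apply Subtype.ext
    change (s : A) * t * w (s * t) = s * (t * w t)
    rw [hw.eq_mul_left t (s * t) s rfl, ← idem_central (idem_mul_inv (s : A))]
    calc (s : A) * t * ((s : A) * (s : A)⁻¹ * w t)
        = s * (t * ((s : A) * (s : A)⁻¹)) * w t := by simp only [mul_assoc]
      _ = _ := by
          rw [← idem_central (idem_mul_inv (s : A)), SemilatticeOfGroups.mul_inv_eq_inv_mul]
          simp only [mul_assoc, mul_inv_cancel_mul]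
  mul_left s t := by
    apply Subtype.ext
    change (s : A) * (w t * t) = s * w s * t
    -- Both sides equal $w(st)$, computed by absorbing $t$ on the right or $s$ on the left.
    have h : w s * ((t : A) * (t : A)⁻¹) = w t * ((s : A) * (s : A)⁻¹) :=
      (hw.eq_mul_right s (s * t) t rfl).symm.trans (hw.eq_mul_left t (s * t) s rfl)
    calc (s : A) * (w t * t) = s * (s * (s : A)⁻¹) * (w t * t) := by
          rw [SemilatticeOfGroups.mul_inv_eq_inv_mul, mul_inv_mul']
      _ = s * (s * (s : A)⁻¹ * w t) * t := by simp only [mul_assoc]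
      _ = s * w s * (t * (t : A)⁻¹ * t) := by
          rw [idem_central (idem_mul_inv (s : A)), ← h]
          simp only [mul_assoc]
      _ = s * w s * t := by rw [mul_inv_mul]

/-- Multiplying $c$ by $v(c)$ stays inside the subgroup of $c$, where a cocycle is constant:
$w(v(c)c)=w(c)\,v(c)v(c)^{-1}=w(c)\,cc^{-1}=w(c)$. Hence composing cocycle multipliers amounts to
multiplying cocycles pointwise. -/
theorem IsCocycle.apply_mul_left (hw : IsCocycle R w) {v : R → A} (hv : IsCocycle R v) (c d : R)
    (h : (d : A) = v c * c) : w d = w c := by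
  rw [hw.eq_mul_left c d _ h, hv.mul_inv, hw.mul_mul_inv]

theorem IsCocycle.apply_mul_right (hw : IsCocycle R w) {v : R → A} (hv : IsCocycle R v) (c d : R)
    (h : (d : A) = c * v c) : w d = w c := by
  rw [hw.eq_mul_right c d _ h, hv.mul_inv, hw.mul_mul_inv]

theorem ofCocycle_mul_eq_one (hR : IsTwoSidedIdeal (R : Set A)) (hw : IsCocycle R w)
    {v : R → A} (hv : IsCocycle R v) (h : ∀ c : R, w c * v c = (c : A) * (c : A)⁻¹) :
    ofCocycle hR hw * ofCocycle hR hv = 1 := by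
  apply Multiplier.ext
  · funext c
    apply Subtype.ext
    change w ⟨v c * c, (hR c c.2 _).1⟩ * (v c * c) = c
    rw [hw.apply_mul_left hv c _ rfl, ← mul_assoc, h, mul_inv_mul]
  · funext c
    apply Subtype.ext
    change c * w c * v ⟨c * w c, (hR c c.2 _).2⟩ = (c : A)
    rw [hv.apply_mul_right hw c _ rfl, mul_assoc, h, SemilatticeOfGroups.mul_inv_eq_inv_mul,
      mul_inv_mul']

/-- The invertible multiplier given by a cocycle. -/
def unitOfCocycle (hR : IsTwoSidedIdeal (R : Set A)) (hw : IsCocycle R w) : (Multiplier R)ˣ where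
  val := ofCocycle hR hw
  inv := ofCocycle hR hw.inv
  val_inv := ofCocycle_mul_eq_one hR hw hw.inv hw.mul_inv
  inv_val := ofCocycle_mul_eq_one hR hw.inv hw fun c => by
    rw [← SemilatticeOfGroups.mul_inv_eq_inv_mul, hw.mul_inv]

/-- The right action of the inverse evaluates $w$ at $w(c)c$ rather than at $c$; these values agree
because $w$ is constant on the subgroup of $c$. -/
theorem coe_conj_unitOfCocycle (hR : IsTwoSidedIdeal (R : Set A)) (hw : IsCocycle R w) (c : R) :
    ((conj (unitOfCocycle hR hw) c : R) : A) = w c * c * (w c)⁻¹ := by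
  have h : w ⟨w c * c, (hR c c.2 _).1⟩ = w c := hw.apply_mul_left hw c _ rfl
  change w c * c * (w ⟨w c * c, (hR c c.2 _).1⟩)⁻¹ = _
  rw [h]

end Cocycle

end Multiplier

/-! ### Identity maps of ideals -/

namespace IdealIso

section Identity

variable {A : Type*} [InverseSemigroup A]

theorem ext_mem {φ ψ : IdealIso A} (h : ∀ a b, b ∈ φ.toPEquiv a ↔ b ∈ ψ.toPEquiv a) : φ = ψ :=
  IdealIso.ext (PEquiv.ext fun a => Option.ext fun b => h a b)

open Classical in
/-- The identity map of an ideal. -/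
noncomputable def idOn (I : Set A) (hI : IsTwoSidedIdeal I) : IdealIso A where
  toPEquiv := PEquiv.ofSet I
  dom_ideal := fun a ⟨b, hb⟩ x => by
    obtain ⟨rfl, ha⟩ := PEquiv.mem_ofSet_iff.1 hb
    exact ⟨⟨_, PEquiv.mem_ofSet_iff.2 ⟨rfl, (hI _ ha x).1⟩⟩,
      ⟨_, PEquiv.mem_ofSet_iff.2 ⟨rfl, (hI _ ha x).2⟩⟩⟩
  ran_ideal := fun a ⟨b, hb⟩ x => by
    obtain ⟨rfl, ha⟩ := PEquiv.mem_ofSet_iff.1 hb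
    exact ⟨⟨_, PEquiv.mem_ofSet_iff.2 ⟨rfl, (hI _ ha x).1⟩⟩,
      ⟨_, PEquiv.mem_ofSet_iff.2 ⟨rfl, (hI _ ha x).2⟩⟩⟩
  map_mul := fun a a' b b' h h' => by
    obtain ⟨rfl, ha⟩ := PEquiv.mem_ofSet_iff.1 h
    obtain ⟨rfl, -⟩ := PEquiv.mem_ofSet_iff.1 h'
    exact PEquiv.mem_ofSet_iff.2 ⟨rfl, (hI _ ha _).2⟩

theorem mem_idOn {I : Set A} {hI : IsTwoSidedIdeal I} {a b : A} :
    b ∈ (idOn I hI).toPEquiv a ↔ b = a ∧ b ∈ I := by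
  classical
  exact PEquiv.mem_ofSet_iff

theorem mem_idOn_mul {I : Set A} {hI : IsTwoSidedIdeal I} {φ : IdealIso A} {a b : A} :
    b ∈ (idOn I hI * φ).toPEquiv a ↔ b ∈ φ.toPEquiv a ∧ b ∈ I := by
  rw [mem_mul]
  constructor
  · rintro ⟨c, hc, h⟩
    obtain ⟨rfl, hI⟩ := mem_idOn.1 h
    exact ⟨hc, hI⟩
  · rintro ⟨h, hb⟩
    exact ⟨b, h, mem_idOn.2 ⟨rfl, hb⟩⟩

theorem mem_mul_idOn {I : Set A} {hI : IsTwoSidedIdeal I} {φ : IdealIso A} {a b : A} :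
    b ∈ (φ * idOn I hI).toPEquiv a ↔ b ∈ φ.toPEquiv a ∧ a ∈ I := by
  rw [mem_mul]
  constructor
  · rintro ⟨c, h, hc⟩
    obtain ⟨rfl, hI⟩ := mem_idOn.1 h
    exact ⟨hc, hI⟩
  · rintro ⟨h, hb⟩
    exact ⟨a, mem_idOn.2 ⟨rfl, hb⟩, h⟩

end Identity

end IdealIso

/-! ### Idempotents, order preservation and $\theta_1$ -/

section Ext

variable {A U S : Type*} [SemilatticeOfGroups A] [InverseSemigroup U] [InverseSemigroup S]

/-- Since $j$ separates idempotents, $j\circ i$ identifies $aa^{-1}$ with an idempotent of $S$, so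
questions about which subgroup of $A$ contains an element can be settled in $S$. -/
theorem Extension.mul_inv_eq_of_j_i_eq (E : Extension A U S) {a b : A}
    (h : E.j (E.i a) = E.j (E.i b)) : a * a⁻¹ = b * b⁻¹ := by
  apply E.i_injective
  refine E.j_separating _ _ ?_ ?_ (by rw [E.j_i_mul_inv, E.j_i_mul_inv, h])
  · rw [map_mul, map_inv']
    exact idem_mul_inv _
  · rw [map_mul, map_inv']
    exact idem_mul_inv _

namespace OrderPreservingTransversal

variable {E : Extension A U S} (T : OrderPreservingTransversal E)

/-- The form in which order preservation enters the twist computation. An element below $\rho(s)$ is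
determined by its range idempotent, and that idempotent is determined by its image under $j$. -/
theorem ρ_idem_mul {q : U} (hq : IsIdempotentElem q) (s : S) :
    T.ρ (E.j q * s) = q * T.ρ s := by
  have hjq : IsIdempotentElem (E.j q) := by
    unfold IsIdempotentElem
    rw [← map_mul, hq.eq]
  have h1 := natLE_left (T.ρ_mono _ _ ⟨E.j q, hjq, rfl⟩ : NatLE (T.ρ (E.j q * s)) (T.ρ s))
  have h2 : T.ρ (E.j q * s) * (T.ρ (E.j q * s))⁻¹ = q * (T.ρ s * (T.ρ s)⁻¹) := by
    refine E.j_separating _ _ (idem_mul_inv _) (idem_mul hq (idem_mul_inv _)) ?_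
    rw [map_mul, map_inv', T.j_ρ, map_mul, map_mul, map_inv', T.j_ρ, mul_inv_rev', idem_inv hjq]
    calc E.j q * s * (s⁻¹ * E.j q) = E.j q * ((s * s⁻¹) * E.j q) := by simp only [mul_assoc]
      _ = E.j q * (s * s⁻¹) := by
        rw [idem_comm (idem_mul_inv s) hjq, ← mul_assoc, hjq.eq]
  rw [h1, h2, mul_assoc, mul_inv_mul]

theorem theta_one [Nonempty S] (hS : IsEUnitary S) : T.theta hS 1 = 1 := by
  have key : ∀ a, T.ThetaRel 1 a a := by
    intro a
    have hp := E.j_i_idem a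
    have hk : IsIdempotentElem (E.i (a * a⁻¹)) := by
      rw [map_mul, map_inv']
      exact idem_mul_inv _
    -- The idempotent $j(i(a))$ lies in the class $1$, and $\rho$ sends it to $i(aa^{-1})$,
    -- conjugation by which fixes $i(a)$.
    refine T.thetaRel_iff.2 ⟨E.j (E.i a), toMaxGroup_idem_eq_one hp, ?_, ?_⟩
    · rw [idem_inv hp, hp.eq]
    · have h : T.ρ (E.j (E.i a)) = E.i (a * a⁻¹) :=
        E.j_separating _ _ (T.ρ_idem _ hp) hk (by rw [T.j_ρ, E.j_i_mul_inv])
      rw [h, idem_inv hk, ← map_mul, ← map_mul, mul_inv_mul,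
        SemilatticeOfGroups.mul_inv_eq_inv_mul, mul_inv_mul']
  apply IdealIso.ext_mem
  intro a b
  rw [T.mem_theta]
  have h1 : b ∈ (1 : IdealIso A).toPEquiv a ↔ a = b := Option.some_inj
  rw [h1]
  exact ⟨fun h => T.thetaRel_fun hS (key a) h, fun h => h ▸ key a⟩

/-! ### The twist -/

/-- `w` is the value at `c` of the twist relating `θ_g θ_{g⁻¹k}` and `θ_k`. -/
def TwistRel (g k : MaxGroupImage S) (c w : A) : Prop :=
  ∃ s r : S, toMaxGroup s = g ∧ toMaxGroup r = k ∧ s * s⁻¹ = E.j (E.i c) ∧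
    r * r⁻¹ = E.j (E.i c) ∧ E.i w = T.ρ s * T.ρ (s⁻¹ * r) * (T.ρ r)⁻¹

variable {T}

/-- E-unitarity leaves at most one $s\in g$ and one $r\in k$ with the prescribed range, so the
relation is the graph of a partial function of $c$. -/
theorem TwistRel.unique (hS : IsEUnitary S) {g k : MaxGroupImage S} {c v w : A}
    (h : T.TwistRel g k c v) (h' : T.TwistRel g k c w) : v = w := by
  obtain ⟨s, r, hs, hr, h1, h2, h3⟩ := h
  obtain ⟨s', r', hs', hr', h1', h2', h3'⟩ := h'
  obtain rfl := eq_of_ran_eq hS (hs.trans hs'.symm) (h1.trans h1'.symm)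
  obtain rfl := eq_of_ran_eq hS (hr.trans hr'.symm) (h2.trans h2'.symm)
  exact E.i_injective (h3.trans h3'.symm)

theorem TwistRel.congr {g k : MaxGroupImage S} {c d w : A} (h : T.TwistRel g k c w)
    (hd : E.j (E.i d) = E.j (E.i c)) : T.TwistRel g k d w := by
  unfold TwistRel
  rwa [hd]

/-- Under $j\circ i$ the twist becomes $ss^{-1}rr^{-1}$, the idempotent of $c$; so $w$ belongs to
the subgroup of $c$. -/
theorem TwistRel.mul_inv {g k : MaxGroupImage S} {c w : A} (h : T.TwistRel g k c w) :
    w * w⁻¹ = c * c⁻¹ := by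
  obtain ⟨s, r, -, -, h1, h2, h3⟩ := h
  apply E.mul_inv_eq_of_j_i_eq
  rw [h3, map_mul, map_mul, map_inv', T.j_ρ, T.j_ρ, T.j_ρ]
  calc s * (s⁻¹ * r) * r⁻¹ = s * s⁻¹ * (r * r⁻¹) := by simp only [mul_assoc]
    _ = E.j (E.i c) := by rw [h1, h2, (E.j_i_idem c).eq]

/-- Passing from $c$ to $cx$ cuts $s$ and $r$ down by the idempotent $j(i(x))$. By `ρ_idem_mul` the
three factors of the twist are then multiplied by idempotents of $U$, which collect to $q\,i(w)\,q$
with $q=i(xx^{-1})$; centrality of $xx^{-1}$ makes this $i(w\,xx^{-1})$. -/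
theorem TwistRel.mul_right {g k : MaxGroupImage S} {c w : A} (h : T.TwistRel g k c w) (x : A) :
    T.TwistRel g k (c * x) (w * (x * x⁻¹)) := by
  obtain ⟨s, r, hs, hr, h1, h2, h3⟩ := h
  have hx := E.j_i_idem x
  set q := E.i (x * x⁻¹) with hq
  have hqi : IsIdempotentElem q := by
    rw [hq, map_mul, map_inv']
    exact idem_mul_inv _
  have hjq : E.j q = E.j (E.i x) := E.j_i_mul_inv x
  have hran : ∀ t : S, t * t⁻¹ = E.j (E.i c) →
      E.j (E.i x) * t * (E.j (E.i x) * t)⁻¹ = E.j (E.i (c * x)) := by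
    intro t ht
    rw [mul_inv_rev', idem_inv hx, map_mul, map_mul, ← ht]
    calc E.j (E.i x) * t * (t⁻¹ * E.j (E.i x)) = E.j (E.i x) * (t * t⁻¹) * E.j (E.i x) := by
          simp only [mul_assoc]
      _ = _ := by rw [idem_comm hx (idem_mul_inv t), mul_assoc, hx.eq]
  -- The middle argument is $s^{-1}r$ multiplied by the idempotent $s^{-1}j(q)s$. Writing that
  -- idempotent as the image of $\rho(s)^{-1}q\rho(s)$ lets `ρ_idem_mul` apply to the middle factor
  -- too.
  have hmid : (E.j q * s)⁻¹ * (E.j q * r) = E.j ((T.ρ s)⁻¹ * q * T.ρ s) * (s⁻¹ * r) := by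
    rw [hjq, mul_inv_rev', idem_inv hx, map_mul, map_mul, map_inv', T.j_ρ, hjq]
    calc s⁻¹ * E.j (E.i x) * (E.j (E.i x) * r) = s⁻¹ * (E.j (E.i x) * E.j (E.i x)) * r := by
          simp only [mul_assoc]
      _ = s⁻¹ * (s * s⁻¹) * E.j (E.i x) * r := by rw [hx.eq, ← mul_assoc, inv_mul_inv]
      _ = s⁻¹ * (s * s⁻¹ * E.j (E.i x)) * r := by simp only [mul_assoc]
      _ = _ := by
          rw [idem_comm (idem_mul_inv s) hx]
          simp only [mul_assoc]
  have hmi : IsIdempotentElem ((T.ρ s)⁻¹ * q * T.ρ s) := by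
    have := idem_conj hqi (T.ρ s)⁻¹
    rwa [inv_inv'] at this
  refine ⟨E.j (E.i x) * s, E.j (E.i x) * r, ?_, ?_, hran s h1, hran r h2, ?_⟩
  · rw [← hs]
    exact toMaxGroup_of_le ⟨_, hx, rfl⟩
  · rw [← hr]
    exact toMaxGroup_of_le ⟨_, hx, rfl⟩
  · rw [← hjq, hmid, T.ρ_idem_mul hqi, T.ρ_idem_mul hqi, T.ρ_idem_mul hmi, mul_inv_rev',
      idem_inv hqi]
    calc E.i (w * (x * x⁻¹)) = E.i (x * x⁻¹ * w * (x * x⁻¹)) := by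
          rw [idem_central (idem_mul_inv x), mul_assoc, (idem_mul_inv x).eq]
      _ = q * (T.ρ s * T.ρ (s⁻¹ * r) * (T.ρ r)⁻¹) * q := by rw [map_mul, map_mul, h3]
      _ = q * q * (T.ρ s * (T.ρ s)⁻¹) * T.ρ s * T.ρ (s⁻¹ * r) * (T.ρ r)⁻¹ * q := by
          rw [hqi.eq]
          simp only [mul_assoc, mul_inv_cancel_mul]
      _ = q * (q * (T.ρ s * (T.ρ s)⁻¹)) * T.ρ s * T.ρ (s⁻¹ * r) * (T.ρ r)⁻¹ * q := by
          simp only [mul_assoc]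
      _ = _ := by
          rw [idem_comm hqi (idem_mul_inv _)]
          simp only [mul_assoc]

theorem exists_twistRel {g k : MaxGroupImage S} {c : A} (hg : ∃ a, T.ThetaRel g a c)
    (hk : ∃ a, T.ThetaRel k a c) : ∃ w, T.TwistRel g k c w := by
  obtain ⟨s, hs, h1⟩ := T.thetaRel_ran.1 hg
  obtain ⟨r, hr, h2⟩ := T.thetaRel_ran.1 hk
  obtain ⟨w, hw⟩ := E.exists_of_idem (u := T.ρ s * T.ρ (s⁻¹ * r) * (T.ρ r)⁻¹) (by
    -- Under $j$ the product becomes $ss^{-1}\cdot rr^{-1}$, an idempotent, so it lies in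
    -- $j^{-1}(E(S))=i(A)$.
    rw [map_mul, map_mul, map_inv', T.j_ρ, T.j_ρ, T.j_ρ, ← mul_assoc, mul_assoc]
    exact idem_mul (idem_mul_inv s) (idem_mul_inv r))
  exact ⟨w, s, r, hs, hr, h1, h2, hw⟩

variable (T)

/-- Uniqueness of the twist turns `TwistRel.mul_right` into the cocycle equations for any choice of
values. -/
theorem exists_isCocycle (hS : IsEUnitary S) (g k : MaxGroupImage S) (R : Subsemigroup A)
    (hR : ∀ c ∈ R, (∃ a, T.ThetaRel g a c) ∧ ∃ a, T.ThetaRel k a c) :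
    ∃ w : R → A, Multiplier.IsCocycle R w ∧ ∀ c : R, T.TwistRel g k c (w c) := by
  choose w hw using fun c : R => exists_twistRel (hR c c.2).1 (hR c c.2).2
  refine ⟨w, ⟨fun c => (hw c).mul_inv, ?_, ?_⟩, hw⟩
  · intro c d x h
    exact (hw d).unique hS (h ▸ (hw c).mul_right x)
  · intro c d x h
    -- The left rule follows from the right one: the twist sees its argument only through $j\circ
    -- i$, whose idempotent values commute, so $xc$ and $cx$ have the same twist.
    refine (hw d).unique hS (((hw c).mul_right x).congr ?_)
    rw [h, map_mul, map_mul, map_mul, map_mul, idem_comm (E.j_i_idem x) (E.j_i_idem _)]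

/-! ### Comparison of $\theta_g\theta_h$ with $\theta_{gh}$ -/

/-- The composite `θ_g θ_h` in terms of `gh`. -/
theorem exists_thetaRel_comp_iff [Nonempty S] {g h : MaxGroupImage S} {a c : A} :
    (∃ b, T.ThetaRel h a b ∧ T.ThetaRel g b c) ↔
      ∃ s r : S, toMaxGroup s = g ∧ toMaxGroup r = g * h ∧ s * s⁻¹ = r * r⁻¹ ∧
        r⁻¹ * r = E.j (E.i a) ∧
        E.i c = T.ρ s * T.ρ (s⁻¹ * r) * E.i a * (T.ρ s * T.ρ (s⁻¹ * r))⁻¹ := by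
  simp only [thetaRel_iff]
  constructor
  · rintro ⟨b, ⟨t, ht, hd, hb⟩, s, hs, hd', hc⟩
    have hst : s⁻¹ * s = t * t⁻¹ := hd'.trans (T.ran_eq hd hb).symm
    have hsst : s⁻¹ * (s * t) = t := by rw [← mul_assoc, hst, mul_inv_mul]
    -- Composability of $s$ and $t$ means that $(s,t)$ and $(s,r)=(s,st)$ carry the same
    -- information, with $t$ recovered as $s^{-1}r$; the converse direction uses this substitution.
    refine ⟨s, s * t, hs, by rw [toMaxGroup_mul, hs, ht], ?_, ?_, ?_⟩
    · calc s * s⁻¹ = s * (s⁻¹ * s) * s⁻¹ := by rw [mul_inv_mul']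
        _ = _ := by rw [hst, mul_inv_rev']; simp only [mul_assoc]
    · rw [mul_inv_rev', mul_assoc, hsst, hd]
    · rw [hsst, hc, hb, mul_inv_rev']
      simp only [mul_assoc]
  · rintro ⟨s, r, hs, hr, hsr, hd, hc⟩
    have hd' : (s⁻¹ * r)⁻¹ * (s⁻¹ * r) = E.j (E.i a) := by
      rw [mul_inv_rev', inv_inv', ← hd]
      calc r⁻¹ * s * (s⁻¹ * r) = r⁻¹ * (s * s⁻¹) * r := by simp only [mul_assoc]
        _ = _ := by rw [hsr, inv_mul_inv']
    have hb := T.i_lam (s⁻¹ * r) a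
    refine ⟨T.lam (s⁻¹ * r) a, ⟨s⁻¹ * r, ?_, hd', hb⟩, s, hs, ?_, ?_⟩
    · rw [toMaxGroup_mul, toMaxGroup_inv, hs, hr, inv_mul_cancel_left]
    · rw [← T.ran_eq hd' hb, mul_inv_rev', inv_inv']
      calc s⁻¹ * s = s⁻¹ * (s * s⁻¹) * s := by rw [inv_mul_inv']
        _ = _ := by rw [hsr]; simp only [mul_assoc]
    · rw [hb, hc, mul_inv_rev']
      simp only [mul_assoc]

/-- The part of `θ_{gh}` with values in the range of `θ_g`. -/
theorem thetaRel_mul_and_ran_iff {g h : MaxGroupImage S} [Nonempty S] {a c : A} :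
    (T.ThetaRel (g * h) a c ∧ ∃ a', T.ThetaRel g a' c) ↔
      ∃ s r : S, toMaxGroup s = g ∧ toMaxGroup r = g * h ∧ s * s⁻¹ = r * r⁻¹ ∧
        r⁻¹ * r = E.j (E.i a) ∧ E.i c = T.ρ r * E.i a * (T.ρ r)⁻¹ := by
  rw [thetaRel_ran, thetaRel_iff]
  constructor
  · rintro ⟨⟨r, hr, hd, hc⟩, s, hs, h⟩
    exact ⟨s, r, hs, hr, h.trans (T.ran_eq hd hc).symm, hd, hc⟩
  · rintro ⟨s, r, hs, hr, hsr, hd, hc⟩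
    exact ⟨⟨r, hr, hd, hc⟩, s, hs, hsr.trans (T.ran_eq hd hc)⟩

/-- Let $r\in gh$ carry $a$ to $c$. An element $t\in h$ with the domain of $r$ yields $rt^{-1}\in g$
with the range of $r$; conversely $s\in g$ with the range of $r$ yields $s^{-1}r\in h$ with its
domain. -/
theorem thetaRel_mul_and_dom_iff {g h : MaxGroupImage S} [Nonempty S] {a c : A} :
    (T.ThetaRel (g * h) a c ∧ ∃ b, T.ThetaRel h a b) ↔
      T.ThetaRel (g * h) a c ∧ ∃ a', T.ThetaRel g a' c := by
  refine and_congr_right fun hac => ?_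
  rw [thetaRel_iff] at hac
  obtain ⟨r, hr, hd, hc⟩ := hac
  have hran := T.ran_eq hd hc
  rw [thetaRel_dom, thetaRel_ran, ← hd, ← hran]
  constructor
  · rintro ⟨t, ht, h⟩
    refine ⟨r * t⁻¹, by rw [toMaxGroup_mul, toMaxGroup_inv, hr, ht, mul_inv_cancel_right], ?_⟩
    rw [mul_inv_rev', inv_inv']
    calc r * t⁻¹ * (t * r⁻¹) = r * (t⁻¹ * t) * r⁻¹ := by simp only [mul_assoc]
      _ = _ := by rw [h, mul_inv_mul']
  · rintro ⟨s, hs, h⟩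
    refine ⟨s⁻¹ * r, by rw [toMaxGroup_mul, toMaxGroup_inv, hr, hs, inv_mul_cancel_left], ?_⟩
    rw [mul_inv_rev', inv_inv']
    calc r⁻¹ * s * (s⁻¹ * r) = r⁻¹ * (s * s⁻¹) * r := by simp only [mul_assoc]
      _ = _ := by rw [h, inv_mul_inv']

theorem mem_theta_mul_theta (hS : IsEUnitary S) {g h : MaxGroupImage S} {a c : A} :
    c ∈ (T.theta hS g * T.theta hS h).toPEquiv a ↔
      ∃ b, T.ThetaRel h a b ∧ T.ThetaRel g b c := by
  simp only [IdealIso.mem_mul, mem_theta]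

/-- Up to a twist, `θ_g θ_h` is the part of `θ_{gh}` with values in the range of `θ_g`. -/
theorem sim_theta_mul [Nonempty S] (hS : IsEUnitary S) (g h : MaxGroupImage S) :
    IdealIso.Sim (T.theta hS g * T.theta hS h)
      (IdealIso.idOn _ (T.thetaRel_ran_ideal g) * T.theta hS (g * h)) := by
  set φ := IdealIso.idOn _ (T.thetaRel_ran_ideal g) * T.theta hS (g * h) with hφ
  have hmem : ∀ a c, c ∈ φ.toPEquiv a ↔ T.ThetaRel (g * h) a c ∧ ∃ a', T.ThetaRel g a' c := by
    intro a c
    rw [hφ, IdealIso.mem_idOn_mul, T.mem_theta]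
    rfl
  -- The range of $\varphi$ lies in $\mathcal D_g\cap\mathcal D_{gh}$, where the twist is defined.
  obtain ⟨w, hw, hwt⟩ := T.exists_isCocycle hS g (g * h) φ.ran fun c ⟨a, ha⟩ =>
    have := (hmem a c).1 ha
    ⟨this.2, a, this.1⟩
  have hR : IsTwoSidedIdeal (φ.ran : Set A) := φ.ran_ideal
  have hm : ∀ (a : A) (c : φ.ran), (c : A) ∈ φ.toPEquiv a →
      ((Multiplier.conj (Multiplier.unitOfCocycle hR hw) c : φ.ran) : A) ∈
        (T.theta hS g * T.theta hS h).toPEquiv a := by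
    intro a c hc
    rw [Multiplier.coe_conj_unitOfCocycle, T.mem_theta_mul_theta, exists_thetaRel_comp_iff]
    obtain ⟨s, r, hs, hr, hsr, hd, hic⟩ := T.thetaRel_mul_and_ran_iff.1 ((hmem a c).1 hc)
    refine ⟨s, r, hs, hr, hsr, hd, ?_⟩
    obtain ⟨s', r', hs', hr', h1, h2, h3⟩ := hwt c
    have hrc := T.ran_eq hd hic
    -- The elements defining the twist at $c$ coincide with those computing the composite, as their
    -- classes and ranges agree.
    obtain rfl := eq_of_ran_eq hS (hs.trans hs'.symm) ((hsr.trans hrc).trans h1.symm)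
    obtain rfl := eq_of_ran_eq hS (hr.trans hr'.symm) (hrc.trans h2.symm)
    -- The trailing $\rho(r)^{-1}\rho(r)$ is absorbed because $\rho(s^{-1}r)$ has the same domain
    -- idempotent as $\rho(r)$.
    have hwr : E.i (w c) * T.ρ r = T.ρ s * T.ρ (s⁻¹ * r) := by
      have hdom : (T.ρ (s⁻¹ * r))⁻¹ * T.ρ (s⁻¹ * r) = (T.ρ r)⁻¹ * T.ρ r := by
        refine E.j_separating _ _ (idem_inv_mul _) (idem_inv_mul _) ?_
        rw [map_mul, map_mul, map_inv', map_inv', T.j_ρ, T.j_ρ, mul_inv_rev', inv_inv']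
        calc r⁻¹ * s * (s⁻¹ * r) = r⁻¹ * (s * s⁻¹) * r := by simp only [mul_assoc]
          _ = _ := by rw [hsr, inv_mul_inv']
      rw [h3, mul_assoc, ← hdom, mul_assoc, mul_inv_mul']
    rw [← hwr, map_mul, map_mul, map_inv', hic, mul_inv_rev']
    simp only [mul_assoc]
  have hdom : φ.dom = (T.theta hS g * T.theta hS h).dom := by
    ext a
    constructor
    · rintro ⟨c, hc⟩
      exact ⟨_, hm a ⟨c, a, hc⟩ hc⟩
    · rintro ⟨c, hc⟩
      rw [T.mem_theta_mul_theta, exists_thetaRel_comp_iff] at hc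
      obtain ⟨s, r, hs, hr, hsr, hd, -⟩ := hc
      exact ⟨T.lam r a, (hmem _ _).2
        (T.thetaRel_mul_and_ran_iff.2 ⟨s, r, hs, hr, hsr, hd, T.i_lam r a⟩)⟩
  refine ⟨hdom, ?_, _, hm⟩
  ext c
  constructor
  · rintro ⟨a, hc⟩
    set m := Multiplier.unitOfCocycle hR hw
    -- To reach $c$ by the composite, take $a'$ with $\varphi(a')=m^{-1}cm$; conjugating back by $m$
    -- gives $c$.
    obtain ⟨a', ha'⟩ : ((Multiplier.conj m⁻¹ ⟨c, a, hc⟩ : φ.ran) : A) ∈ φ.ran := Subtype.mem _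
    refine ⟨a', ?_⟩
    have h1 := hm a' _ ha'
    have h2 := IdealIso.conj_conj_inv (IdealIso.ideal_factor hR) m⁻¹ ⟨c, a, hc⟩
    rw [inv_inv] at h2
    rwa [h2] at h1
  · rintro ⟨a, hc⟩
    have ha : a ∈ φ.dom := hdom ▸ (⟨c, hc⟩ : a ∈ (T.theta hS g * T.theta hS h).dom)
    obtain ⟨d, hd⟩ := ha
    have h1 := hm a ⟨d, a, hd⟩ hd
    rw [IdealIso.val_unique _ hc h1]
    exact Subtype.mem _

/-- An equality in $\Sigma(A)$ itself, with no twist. It moves the restriction to the right of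
$\theta_{gh}$, where $\theta_{h^{-1}}$ can absorb it. -/
theorem theta_mul_idOn [Nonempty S] (hS : IsEUnitary S) (g h : MaxGroupImage S) :
    T.theta hS (g * h) * IdealIso.idOn _ (T.thetaRel_dom_ideal h) =
      IdealIso.idOn _ (T.thetaRel_ran_ideal g) * T.theta hS (g * h) := by
  apply IdealIso.ext_mem
  intro a c
  rw [IdealIso.mem_mul_idOn, IdealIso.mem_idOn_mul, T.mem_theta]
  exact T.thetaRel_mul_and_dom_iff

/-- The bijection $s\mapsto s^{-1}$ from $g$ to $g^{-1}$ swaps domain and range idempotents. -/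
theorem thetaRel_inv_dom_iff {g : MaxGroupImage S} [Nonempty S] {a : A} :
    (∃ b, T.ThetaRel g⁻¹ a b) ↔ ∃ b, T.ThetaRel g b a := by
  rw [thetaRel_dom, thetaRel_ran]
  constructor
  · rintro ⟨s, hs, h⟩
    exact ⟨s⁻¹, by rw [toMaxGroup_inv, hs, inv_inv], by rw [inv_inv', h]⟩
  · rintro ⟨s, hs, h⟩
    exact ⟨s⁻¹, by rw [toMaxGroup_inv, hs], by rw [inv_inv', h]⟩

theorem theta_inv_mul_idOn [Nonempty S] (hS : IsEUnitary S) (g : MaxGroupImage S) :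
    T.theta hS g⁻¹ * IdealIso.idOn _ (T.thetaRel_ran_ideal g) = T.theta hS g⁻¹ := by
  apply IdealIso.ext_mem
  intro a c
  rw [IdealIso.mem_mul_idOn, T.mem_theta]
  exact and_iff_left_of_imp fun h => T.thetaRel_inv_dom_iff.1 ⟨c, h⟩

theorem idOn_mul_theta_inv [Nonempty S] (hS : IsEUnitary S) (h : MaxGroupImage S) :
    IdealIso.idOn _ (T.thetaRel_dom_ideal h) * T.theta hS h⁻¹ = T.theta hS h⁻¹ := by
  apply IdealIso.ext_mem
  intro a c
  rw [IdealIso.mem_idOn_mul, T.mem_theta]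
  refine and_iff_left_of_imp fun hc => ?_
  refine (T.thetaRel_inv_dom_iff (g := h⁻¹)).2 ⟨a, hc⟩ |>.imp fun b hb => ?_
  rwa [inv_inv] at hb

end OrderPreservingTransversal

end Ext

/-! ### The identities in $\varsigma(A)$ -/

theorem Varsigma.mk_mul {A : Type*} [InverseSemigroup A] (φ ψ : IdealIso A) :
    Varsigma.mk (φ * ψ) = Varsigma.mk φ * Varsigma.mk ψ := rfl

theorem Varsigma.mk_eq {A : Type*} [InverseSemigroup A] {φ ψ : IdealIso A}
    (h : IdealIso.Sim φ ψ) : Varsigma.mk φ = Varsigma.mk ψ :=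
  (IdealIso.simCon A).eq.2 h

end InverseExt

theorem proposition2p3 {A U S : Type*} [InverseExt.SemilatticeOfGroups A]
    [InverseExt.InverseSemigroup U] [InverseExt.InverseSemigroup S] [Nonempty S]
    (hS : InverseExt.IsEUnitary S) (E : InverseExt.Extension A U S)
    (T : InverseExt.OrderPreservingTransversal E) :
    InverseExt.IsUnitalPartialHom (T.psi hS) := by
  have key : ∀ g h, T.psi hS g * T.psi hS h = InverseExt.Varsigma.mk
      (InverseExt.IdealIso.idOn _ (T.thetaRel_ran_ideal g) * T.theta hS (g * h)) := fun g h =>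
    InverseExt.Varsigma.mk_eq (T.sim_theta_mul hS g h)
  refine ⟨?_, fun g h => ?_, fun g h => ?_⟩
  · exact congrArg InverseExt.Varsigma.mk (T.theta_one hS)
  -- The restriction to $\mathcal D_g$ stands next to $\theta_{g^{-1}}$, which is defined only
  -- there, and so disappears.
  · rw [mul_assoc, key]
    unfold InverseExt.OrderPreservingTransversal.psi
    rw [← InverseExt.Varsigma.mk_mul, ← InverseExt.Varsigma.mk_mul, ← mul_assoc,
      T.theta_inv_mul_idOn hS]
  -- Here the restriction is first turned into one of arguments to $\mathcal D_{h^{-1}}$, which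
  -- contains all values of $\theta_{h^{-1}}$.
  · rw [key, ← T.theta_mul_idOn]
    unfold InverseExt.OrderPreservingTransversal.psi
    rw [← InverseExt.Varsigma.mk_mul, ← InverseExt.Varsigma.mk_mul, mul_assoc,
      T.idOn_mul_theta_inv hS]
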